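/- A *symmetric CW-complex* is a Hausdorff space $X$ with a partition into locally closed subsets (cells) such that for each cell $C$ there are $p\ge 0$ (the dimension of $C$), a finite subgroup $G\le O(p)$ and a continuous map $B^p/G\to X$, where $B^p\subset\mathbb R^p$ is the closed unit ball, such that (1) the quotient $(B^p)^\circ/G$ of the open unit ball is mapped homeomorphically onto $C$, and (2) the image of $B^p/G$ meets only finitely many cells, and those different from $C$ have dimension less than $p$; moreover, a subset of $X$ is closed if and only if its intersection with the closure of every cell is closed. The $p$-skeleton $X^{(p)}$ is the union of the cells of dimension at most $p$, and a subcomplex is a closed union of cells. **Theorem.** Let $X$ be a finite-dimensional symmetric CW-complex (the dimensions of its cells are bounded), let $Z\subset X$ be a subcomplex, let $A$ be an abelian group, and for $p\ge 1$ let $\{C_i\cong (B^p)^\circ/G_i : i\in I^p\}$ be the $p$-cells of $X$ that are not in $Z$. Put $W^{(p)}=Z\cup X^{(p)}$ for $p\ge 0$ and $W^{(p)}=\emptyset$ for $p<0$. The spectral sequence of the filtration of the singular chain complex $C_*(X;A)$ by the subcomplexes $C_*(W^{(p)};A)$, with differentials $d_r\colon E_r^{p,q}\to E_r^{p-r,q+r-1}$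 ($r\ge 1$, $p,q\in\mathbb Z$), satisfies $$E_1^{0,q}\cong H_q(Z\cup X^{(0)};A),\qquad E_1^{p,q}\cong\bigoplus_{i\in I^p}\widetilde H_{p+q-1}(S^{p-1}/G_i;A)\quad\text{for } p\ge 1,$$ and $E_1^{p,q}=0$ for $p<0$. It converges to $$E_\infty^{p,q}\cong\frac{\operatorname{im}\big(H_{p+q}(W^{(p)};A)\to H_{p+q}(X;A)\big)}{\operatorname{im}\big(H_{p+q}(W^{(p-1)};A)\to H_{p+q}(X;A)\big)},$$ that is, there is an $r_0\ge 1$ such that for all $r\ge r_0$ all differentials $d_r$ vanish and $E_r^{p,q}$ is isomorphic to this quotient for all $p,q$. Here $H_n=0$ and $\widetilde H_n=0$ for $n<0$. -/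

import Mathlib

open CategoryTheory Limits AlgebraicTopology Topology

universe w u

noncomputable section

namespace SymmCW

/-! ### Spectral sequences of filtered spaces -/

/-- A homological functor `F` sends a spectral object in a triangulated category to a spectral
object in an abelian category: apply the functors `F.shift n` and take the connecting maps of the
long exact sequences of `F`. -/
def mapHomological {C ι D : Type*} [Category* C] [Category* ι] [Category* D]
    [HasZeroObject C] [HasShift C ℤ] [Preadditive C] [∀ n : ℤ, (shiftFunctor C n).Additive]
    [Pretriangulated C] [Abelian D] (X : Triangulated.SpectralObject C ι) (F : C ⥤ D)
    [F.IsHomological] [F.ShiftSequence ℤ] : Abelian.SpectralObject D ι where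
  H n := X.ω₁ ⋙ F.shift n
  δ' n₀ n₁ h :=
    { app := fun S => F.homologySequenceδ (X.ω₂.obj S) n₀ n₁ h
      naturality := fun _ _ φ => F.homologySequenceδ_naturality _ _ (X.ω₂.map φ) n₀ n₁ h }
  exact₁' n₀ n₁ h S :=
    (F.homologySequence_exact₁ _ (X.ω₂_obj_distinguished S) n₀ n₁ h).exact_toComposableArrows
  exact₂' n S :=
    (F.homologySequence_exact₂ _ (X.ω₂_obj_distinguished S) n).exact_toComposableArrows
  exact₃' n₀ n₁ h S :=
    (F.homologySequence_exact₃ _ (X.ω₂_obj_distinguished S) n₀ n₁ h).exact_toComposableArrows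

/-- The shape of a homological spectral sequence starting at the first page: the differential
`dʳ` goes from position `(p, q)` to position `(p - r, q + r - 1)`. -/
abbrev pageShape (r : ℤ) : ComplexShape (ℤ × ℤ) := ComplexShape.up' (-r, r - 1)

/-- The indexing data of the homological spectral sequence of an increasing filtration indexed
by `ℤ`. In position `(p, q)`, the `r`-th page is built from the filtration steps
`p - r ≤ p - 1 ≤ p ≤ p + r - 1`, in homological degree `p + q`, i.e. in cohomological degree
`-(p + q)`. -/
@[simps]
def homologicalCore : Abelian.SpectralObject.SpectralSequenceDataCore ℤ pageShape 1 where
  deg pq := -(pq.1 + pq.2)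
  i₀ r pq _ := pq.1 - r
  i₁ pq := pq.1 - 1
  i₂ pq := pq.1
  i₃ r pq _ := pq.1 + r - 1
  le₀₁ r pq hr := by simp; lia
  le₁₂ pq := by simp
  le₂₃ r pq hr := by simp; lia
  hc := by rintro r pq _ rfl _; dsimp; lia
  hc₀₂ := by rintro r pq _ rfl _; dsimp; lia
  hc₁₃ := by rintro r pq _ rfl _; dsimp; lia
  antitone_i₀ r r' pq hr hrr' := by lia
  monotone_i₃ r r' pq hr hrr' := by lia
  i₀_prev := by rintro r r' pq _ rfl _ _; dsimp; lia
  i₃_next := by rintro r r' pq _ rfl _ _; dsimp; lia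

instance {C : Type*} [Category* C] [Abelian C] (Y : Abelian.SpectralObject C ℤ) :
    Y.HasSpectralSequence homologicalCore where
  isZero_H_obj_mk₁_i₀_le _ _ _ hpq _ _ _ _ := (hpq _ rfl).elim
  isZero_H_obj_mk₁_i₃_le r _ pq hpq _ _ _ _ := (hpq (pq - (-r, r - 1)) (by simp)).elim

/-- The spectral object of a diagram `⋯ ⟶ K (p - 1) ⟶ K p ⟶ ⋯` of cochain complexes:
`H^n(i ⟶ j)` is the `n`-th cohomology of the mapping cone of `K i ⟶ K j` (so it is the
cohomology of `K j / K i` if that map is a monomorphism), and the connecting maps are those of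
the long exact sequences of triples. -/
def spectralObjectOfComplexes {C : Type*} [Category* C] [Abelian C]
    (K : ℤ ⥤ CochainComplex C ℤ) : Abelian.SpectralObject C ℤ :=
  mapHomological ((HomotopyCategory.spectralObjectMappingCone C).precomp K)
    (HomotopyCategory.homologyFunctor C (ComplexShape.up ℤ) 0)

/-- The singular chain complex with coefficients in `A`, as a cochain complex: `C_n(X; A)` sits
in cohomological degree `-n`. -/
def singularComplex (A : AddCommGrpCat.{u}) :
    TopCat.{u} ⥤ CochainComplex AddCommGrpCat.{u} ℤ :=
  (singularChainComplexFunctor AddCommGrpCat.{u}).obj A ⋙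
    ComplexShape.embeddingDownNat.extendFunctor AddCommGrpCat.{u}

/-- An increasing family of subspaces, as a diagram of spaces and inclusions. -/
def filtrationDiagram {X : Type u} [TopologicalSpace X] (Y : ℤ → Set X) (hY : Monotone Y) :
    ℤ ⥤ TopCat.{u} where
  obj p := TopCat.of (Y p)
  map f := TopCat.ofHom ⟨Set.inclusion (hY (leOfHom f)), continuous_inclusion _⟩

/-- The spectral sequence of a space filtered by subspaces `Y p`, with coefficients in `A`. Its
first page is `E¹_{p,q} = H_{p+q}(Y p, Y (p - 1); A)`. -/
def filtrationSpectralSequence {X : Type u} [TopologicalSpace X] (A : AddCommGrpCat.{u})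
    (Y : ℤ → Set X) (hY : Monotone Y) : SpectralSequence AddCommGrpCat.{u} pageShape 1 :=
  (spectralObjectOfComplexes (filtrationDiagram Y hY ⋙ singularComplex A)).spectralSequence
    homologicalCore

/-! ### Singular homology in integer degrees -/

/-- Singular homology with coefficients in `A`, in all integer degrees; it is `0` in negative
degrees. -/
def homologyInt (A : AddCommGrpCat.{u}) [HasCoproducts.{w} AddCommGrpCat.{u}] :
    ℤ → TopCat.{w} ⥤ AddCommGrpCat.{u}
  | .ofNat n => (singularHomologyFunctor AddCommGrpCat.{u} n).obj A
  | .negSucc _ => (Functor.const _).obj (AddCommGrpCat.of PUnit.{u + 1})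

/-- The reduced homology of a nonempty space: the kernel of the map to the homology of a
point. -/
def reducedHomology (A : AddCommGrpCat.{u}) [HasCoproducts.{w} AddCommGrpCat.{u}] (n : ℤ)
    (X : TopCat.{w}) : AddCommGrpCat.{u} :=
  kernel ((homologyInt A n).map
    (TopCat.ofHom (ContinuousMap.const X PUnit.unit) : X ⟶ TopCat.of PUnit.{w + 1}))

/-- The image of `H_n(Y; A) → H_n(X; A)` for a subspace `Y` of `X`. -/
def homologyImage {X : Type u} [TopologicalSpace X] (A : AddCommGrpCat.{u}) (n : ℤ)
    (Y : Set X) : AddSubgroup ((homologyInt A n).obj (TopCat.of X)) :=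
  ((homologyInt A n).map
    (TopCat.ofHom ⟨Subtype.val, continuous_subtype_val⟩ : TopCat.of Y ⟶ TopCat.of X)).hom.range

/-- The quotient `im (H_n(Y; A) → H_n(X; A)) / im (H_n(Y'; A) → H_n(X; A))` (used for
`Y' ⊆ Y`). -/
def gradedPiece {X : Type u} [TopologicalSpace X] (A : AddCommGrpCat.{u}) (n : ℤ)
    (Y Y' : Set X) : AddCommGrpCat.{u} :=
  AddCommGrpCat.of
    (homologyImage A n Y ⧸ (homologyImage A n Y').addSubgroupOf (homologyImage A n Y))

/-! ### Symmetric CW-complexes -/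

/-- Euclidean space `ℝᵖ`. -/
abbrev E (p : ℕ) : Type := EuclideanSpace ℝ (Fin p)

/-- The orthogonal group `O(p)`. -/
abbrev O (p : ℕ) : Type := E p ≃ₗᵢ[ℝ] E p

/-- Two points of `s` are equivalent if an element of `G` maps one to the other. -/
def orbitSetoid {p : ℕ} (G : Subgroup (O p)) (s : Set (E p)) : Setoid s where
  r x y := ∃ g ∈ G, g (x : E p) = y
  iseqv :=
    { refl := fun _ => ⟨1, G.one_mem, rfl⟩
      symm := by
        rintro x y ⟨g, hg, h⟩
        exact ⟨g⁻¹, G.inv_mem hg, by rw [← h]; exact g.symm_apply_apply _⟩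
      trans := by
        rintro x y z ⟨g, hg, h⟩ ⟨g', hg', h'⟩
        exact ⟨g' * g, G.mul_mem hg' hg, by rw [← h', ← h]; rfl⟩ }

/-- The quotient `s / G`, with the quotient topology, for a `G`-invariant subset `s` of `ℝᵖ`
(below: the open unit ball, the closed unit ball and the unit sphere). -/
abbrev OrbitSpace {p : ℕ} (G : Subgroup (O p)) (s : Set (E p)) : Type :=
  Quotient (orbitSetoid G s)

/-- The map `s / G → t / G` induced by an inclusion `s ⊆ t`. -/
def OrbitSpace.incl {p : ℕ} (G : Subgroup (O p)) {s t : Set (E p)} (h : s ⊆ t) :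
    OrbitSpace G s → OrbitSpace G t :=
  Quotient.map (Set.inclusion h) (fun _ _ hxy => hxy)

/-- A symmetric CW-complex structure on a Hausdorff space `X`, together with a choice of
characteristic maps `Bᵖ / G → X` of its cells. -/
structure SymmetricCWComplex (X : Type u) [TopologicalSpace X] [T2Space X] where
  /-- the index type of the cells -/
  Cell : Type u
  /-- the cells, as subsets of `X` -/
  cell : Cell → Set X
  /-- the dimension of a cell -/
  dim : Cell → ℕ
  /-- the group attached to a cell -/
  G : ∀ i, Subgroup (O (dim i))
  finite_G : ∀ i, Finite (G i)
  /-- the map from the quotient of the closed unit ball -/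
  char : ∀ i, C(OrbitSpace (G i) (Metric.closedBall 0 1), X)
  /-- the cells partition `X` (they are nonempty by `range_char`) -/
  disjoint : Pairwise fun i j => Disjoint (cell i) (cell j)
  cover : ⋃ i, cell i = Set.univ
  locallyClosed : ∀ i, IsLocallyClosed (cell i)
  /-- the quotient of the open unit ball maps homeomorphically onto the cell -/
  range_char : ∀ i,
    Set.range (char i ∘ OrbitSpace.incl (G i) Metric.ball_subset_closedBall) = cell i
  isEmbedding_char : ∀ i,
    IsEmbedding (char i ∘ OrbitSpace.incl (G i) Metric.ball_subset_closedBall)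
  /-- the image of the closed ball meets only finitely many cells, and apart from the cell
  itself they are of smaller dimension -/
  finite_meets : ∀ i, {j | (Set.range (char i) ∩ cell j).Nonempty}.Finite
  dim_lt : ∀ i j, j ≠ i → (Set.range (char i) ∩ cell j).Nonempty → dim j < dim i
  /-- the weak topology -/
  isClosed_iff : ∀ B : Set X, IsClosed B ↔ ∀ i, IsClosed (B ∩ closure (cell i))

namespace SymmetricCWComplex

variable {X : Type u} [TopologicalSpace X] [T2Space X] (S : SymmetricCWComplex X)

/-- The dimensions of the cells are bounded. -/
def FiniteDimensional : Prop := ∃ n : ℕ, ∀ i, S.dim i ≤ n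

/-- A subcomplex is a closed union of cells. -/
def IsSubcomplex (Z : Set X) : Prop :=
  IsClosed Z ∧ ∃ J : Set S.Cell, Z = ⋃ i ∈ J, S.cell i

/-- The `p`-skeleton: the union of the cells of dimension at most `p`. -/
def skeleton (p : ℤ) : Set X := ⋃ (i : S.Cell) (_ : (S.dim i : ℤ) ≤ p), S.cell i

/-- The filtration of `X` by `Z ∪ X⁽ᵖ⁾` for `0 ≤ p`, and by `∅` for `p < 0`. -/
def relFiltration (Z : Set X) (p : ℤ) : Set X := {x | 0 ≤ p ∧ x ∈ Z ∪ S.skeleton p}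

lemma monotone_relFiltration (Z : Set X) : Monotone (S.relFiltration Z) := by
  rintro p p' h x ⟨h0, hx⟩
  refine ⟨h0.trans h, hx.imp id fun hx => ?_⟩
  simp only [skeleton, Set.mem_iUnion] at hx ⊢
  obtain ⟨i, hi, hx⟩ := hx
  exact ⟨i, hi.trans h, hx⟩

/-- The spectral sequence of the filtration by `Z ∪ X⁽ᵖ⁾`. -/
def relSpectralSequence (Z : Set X) (A : AddCommGrpCat.{u}) :
    SpectralSequence AddCommGrpCat.{u} pageShape 1 :=
  filtrationSpectralSequence A (S.relFiltration Z) (S.monotone_relFiltration Z)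

/-- The index type of the `p`-cells of `X` that are not in `Z`. -/
abbrev CellsNotIn (Z : Set X) (p : ℕ) : Type u :=
  {i : S.Cell // S.dim i = p ∧ ¬ S.cell i ⊆ Z}

/-- The quotient `Sᵖ⁻¹ / G` of the unit sphere attached to a `p`-cell. -/
abbrev sphereQuotient (i : S.Cell) : TopCat.{0} :=
  TopCat.of (OrbitSpace (S.G i) (Metric.sphere 0 1))

end SymmetricCWComplex

end SymmCW

end

/-!
The spectral sequence is the one of a finite filtration `∅ = W⁽⁻¹⁾ ⊆ W⁽⁰⁾ ⊆ ⋯ ⊆ W⁽ᴺ⁾ = X`, so both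
halves of the theorem come from its description by the homology of mapping cones.

*The first page.* In position `(p, q)` it is the homology of the mapping cone of
`C_*(W⁽ᵖ⁻¹⁾) → C_*(W⁽ᵖ⁾)`, that is, the relative homology `H_{p+q}(W⁽ᵖ⁾, W⁽ᵖ⁻¹⁾; A)`
(`firstPageIso`). For `p ≤ 0` the subspace `W⁽ᵖ⁻¹⁾` is empty and there is nothing else to do. For
`p ≥ 1`, the space `Y = W⁽ᵖ⁾` is obtained from the closed subspace `W = W⁽ᵖ⁻¹⁾` by attaching the
quotients `Bᵖ / G_i` along their boundaries (`SymmetricCWComplex.relAttachment`), and the relative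
homology of such an attachment is computed in `CellAttachment.nonempty_relativeIso`:

* Pushing points away from the centers of the cells deforms the complement `U` of the centers to
  `W`. This uses that the isometries in `G_i` commute with radial maps, and that a product of a
  quotient map with the unit interval is a quotient map. So `U` may replace `W`.
* The open set `U` and the open cells `V i` cover `Y`, and different open cells are disjoint.
  Excision (`nonempty_excisionIso`) identifies the homology relative to `U` with the direct sum of
  the homology of the `V i` relative to `V i ∩ U`: the chains of simplices which are contained in
  one of the sets of the cover compute the homology of `Y` (`quasiIso_smallSimplices`), and modulo
  the chains of `U` they are literally the direct sum of the relative chains of the `V i`.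
* The cell `V i` is contractible to its center and `V i ∩ U` is homotopy equivalent to the quotient
  `Sᵖ⁻¹ / G_i`, which is nonempty. The long exact sequence gives the reduced homology of the
  quotient of the sphere, in one degree lower (`nonempty_relIsoReducedHomology`).

The theorem on small simplices is proved with barycentric subdivision. Subdivision and its homotopy
to the identity are constructed on chains of affine simplices in a standard simplex, and are
transported to singular chains by the action of affine maps on singular simplices.

*Convergence.* A page differential `d_r` with `r > N` starts or ends outside the range `0 ≤ p ≤ N`,
where all terms vanish. For such `r` and `0 ≤ p ≤ N`, the term in position `(p, q)` is a quotient of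
the homology of `W⁽ᵖ⁾`, as `W⁽ᵖ⁻ʳ⁾` is empty, and a class is zero in it exactly if its image in the homology
of `W⁽ᵖ⁺ʳ⁻¹⁾ = X` comes from `W⁽ᵖ⁻¹⁾` (`exists_epi_page`). This is the quotient of images in the
theorem (`exists_stable_page`).
-/

noncomputable section

namespace SymmCW

/-! ### Affine chains in a standard simplex -/

/-- The standard topological `n`-simplex. -/
abbrev TopSimplex (n : ℕ) : Type := stdSimplex ℝ (Fin (n + 1))

/-- The affine map between standard simplices with prescribed images of the vertices. -/
def affineMap {m n : ℕ} (w : Fin (m + 1) → TopSimplex n) : C(TopSimplex m, TopSimplex n) where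
  toFun t := ⟨∑ i, t.1 i • (w i).1,
    (convex_stdSimplex ℝ _).sum_mem (fun i _ => t.2.1 i) t.2.2 (fun i _ => (w i).2)⟩
  continuous_toFun := by
    refine Continuous.subtype_mk (continuous_finsetSum _ fun i _ => ?_) _
    exact ((continuous_apply i).comp continuous_subtype_val).smul continuous_const

/-- The vertices of the standard simplex. -/
abbrev stdVertex (n : ℕ) : Fin (n + 1) → TopSimplex n := stdSimplex.vertex

lemma affineMap_vertex {m n : ℕ} (w : Fin (m + 1) → TopSimplex n) (i : Fin (m + 1)) :
    affineMap w (stdVertex m i) = w i := by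
  apply Subtype.ext
  simp only [affineMap, stdVertex, ContinuousMap.coe_mk]
  rw [Finset.sum_eq_single i]
  · simp
  · intro j _ hj; simp [hj]
  · simp

lemma affineMap_stdVertex (n : ℕ) : affineMap (stdVertex n) = ContinuousMap.id _ := by
  ext t : 1
  apply Subtype.ext
  funext j
  simp [affineMap, Finset.sum_apply, Pi.single_apply]

lemma affineMap_comp {k m n : ℕ} (v : Fin (m + 1) → TopSimplex n) (w : Fin (k + 1) → TopSimplex m) :
    affineMap (affineMap v ∘ w) = (affineMap v).comp (affineMap w) := by
  ext t : 1
  apply Subtype.ext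
  simp only [affineMap, ContinuousMap.coe_mk, ContinuousMap.comp_apply, Function.comp]
  simp only [Finset.sum_apply, Pi.smul_apply, Finset.smul_sum, smul_eq_mul, Finset.sum_smul,
    smul_smul]
  rw [Finset.sum_comm]

/-- The barycenter of the points `w 0, …, w m`. -/
def barycenter {m n : ℕ} (w : Fin (m + 1) → TopSimplex n) : TopSimplex n :=
  affineMap w stdSimplex.barycenter

lemma affineMap_barycenter {k m n : ℕ} (v : Fin (m + 1) → TopSimplex n)
    (w : Fin (k + 1) → TopSimplex m) :
    affineMap v (barycenter w) = barycenter (affineMap v ∘ w) := by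
  simp [barycenter, affineMap_comp]

/-- Integral chains of affine simplices with `m` vertices in the standard `n`-simplex. Counting
vertices instead of dimensions includes the augmentation: the case `m = 0` is a copy of `ℤ`,
generated by the empty simplex. -/
abbrev AffineChain (m n : ℕ) : Type := (Fin m → TopSimplex n) →₀ ℤ

namespace AffineChain

variable {k m n : ℕ}

/-- The affine simplex with given vertices, as a chain. -/
abbrev of (w : Fin m → TopSimplex n) : AffineChain m n := Finsupp.single w 1

@[ext high]
lemma hom_ext {M : Type*} [AddCommGroup M] {f g : AffineChain m n →ₗ[ℤ] M}
    (h : ∀ w, f (of w) = g (of w)) : f = g :=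
  Finsupp.lhom_ext' fun w => LinearMap.ext_ring (h w)

/-- The linear extension of a function on affine simplices. -/
def lift {M : Type*} [AddCommGroup M] (f : (Fin m → TopSimplex n) → M) :
    AffineChain m n →ₗ[ℤ] M :=
  Finsupp.linearCombination ℤ f

@[simp]
lemma lift_of {M : Type*} [AddCommGroup M] (f : (Fin m → TopSimplex n) → M)
    (w : Fin m → TopSimplex n) : lift f (of w) = f w := by
  simp [lift]

/-- The boundary of an affine chain. -/
def boundary : AffineChain (m + 1) n →ₗ[ℤ] AffineChain m n :=
  lift fun w => ∑ i : Fin (m + 1), (-1 : ℤ) ^ (i : ℕ) • of (w ∘ i.succAbove)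

/-- The cone on an affine chain with apex `b`. -/
def cone (b : TopSimplex n) : AffineChain m n →ₗ[ℤ] AffineChain (m + 1) n :=
  lift fun w => of (Fin.cons b w : Fin (m + 1) → TopSimplex n)

/-- The image of an affine chain under an affine map. -/
def push (v : Fin (n + 1) → TopSimplex k) : AffineChain m n →ₗ[ℤ] AffineChain m k :=
  lift fun w => of (affineMap v ∘ w)

lemma boundary_of (w : Fin (m + 1) → TopSimplex n) :
    boundary (of w) = ∑ i : Fin (m + 1), (-1 : ℤ) ^ (i : ℕ) • of (w ∘ i.succAbove) :=
  lift_of _ _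

@[simp]
lemma cone_of (b : TopSimplex n) (w : Fin m → TopSimplex n) :
    cone b (of w) = of (Fin.cons b w : Fin (m + 1) → TopSimplex n) := lift_of _ _

@[simp]
lemma push_of (v : Fin (n + 1) → TopSimplex k) (w : Fin m → TopSimplex n) :
    push v (of w) = of (affineMap v ∘ w) := lift_of _ _

lemma boundary_cone_zero (b : TopSimplex n) (x : AffineChain 0 n) : boundary (cone b x) = x := by
  suffices h : boundary ∘ₗ cone b = (LinearMap.id : AffineChain 0 n →ₗ[ℤ] _) from
    LinearMap.congr_fun h x
  ext1 w
  simp only [LinearMap.comp_apply, cone_of, boundary_of, LinearMap.id_apply]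
  simp

/-- The cone is a contracting homotopy. -/
lemma boundary_cone (b : TopSimplex n) (x : AffineChain (m + 1) n) :
    boundary (cone b x) = x - cone b (boundary x) := by
  suffices h : boundary ∘ₗ cone b = (LinearMap.id : AffineChain (m + 1) n →ₗ[ℤ] _) -
      cone b ∘ₗ boundary from LinearMap.congr_fun h x
  ext1 w
  simp only [LinearMap.comp_apply, cone_of, boundary_of, LinearMap.id_apply, LinearMap.sub_apply,
    map_sum, map_smul]
  rw [Fin.sum_univ_succ]
  have h0 : (Fin.cons b w : Fin (m + 2) → TopSimplex n) ∘ (0 : Fin (m + 2)).succAbove = w := by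
    ext1 i; simp
  have h1 (j : Fin (m + 1)) : (Fin.cons b w : Fin (m + 2) → TopSimplex n) ∘ j.succ.succAbove =
      Fin.cons b (w ∘ j.succAbove) := by
    ext1 i
    induction i using Fin.cases with
    | zero => simp
    | succ i => simp
  simp only [h0, h1, Fin.val_zero, pow_zero, one_smul, Fin.val_succ, pow_succ, mul_neg, mul_one,
    neg_smul, Finset.sum_neg_distrib, sub_eq_add_neg]

lemma of_eq_cone (w : Fin (m + 1) → TopSimplex n) : of w = cone (w 0) (of (Fin.tail w)) := by
  simp

lemma boundary_boundary (x : AffineChain (m + 2) n) : boundary (boundary x) = 0 := by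
  suffices h : boundary ∘ₗ boundary = (0 : AffineChain (m + 2) n →ₗ[ℤ] _) from
    LinearMap.congr_fun h x
  clear x
  ext1 w
  induction m with
  | zero =>
    rw [of_eq_cone, LinearMap.comp_apply, boundary_cone, map_sub, boundary_cone_zero, sub_self,
      LinearMap.zero_apply]
  | succ m ih =>
    have := LinearMap.congr_fun (hom_ext (f := boundary ∘ₗ boundary) (g := 0) ih)
    simp only [LinearMap.comp_apply, LinearMap.zero_apply] at this
    rw [of_eq_cone, LinearMap.comp_apply, boundary_cone, map_sub, boundary_cone, this, map_zero,
      sub_zero, sub_self, LinearMap.zero_apply]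

lemma push_boundary (v : Fin (n + 1) → TopSimplex k) (x : AffineChain (m + 1) n) :
    push v (boundary x) = boundary (push v x) := by
  suffices h : push v ∘ₗ boundary = boundary ∘ₗ push (m := m + 1) v from LinearMap.congr_fun h x
  ext1 w
  simp only [LinearMap.comp_apply, boundary_of, map_sum, map_smul, push_of, Function.comp_assoc]

lemma push_cone (v : Fin (n + 1) → TopSimplex k) (b : TopSimplex n) (x : AffineChain m n) :
    push v (cone b x) = cone (affineMap v b) (push v x) := by
  suffices h : push v ∘ₗ cone b = cone (affineMap v b) ∘ₗ push (m := m) v from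
    LinearMap.congr_fun h x
  ext1 w
  simp only [LinearMap.comp_apply, cone_of, push_of]
  congr 1
  ext1 i
  induction i using Fin.cases <;> simp

/-- Barycentric subdivision: the subdivision of a simplex is the cone, with apex the barycenter,
on the subdivision of its boundary. -/
def subdiv : ∀ {m : ℕ}, AffineChain m n →ₗ[ℤ] AffineChain m n
  | 0 => LinearMap.id
  | _ + 1 => lift fun w => cone (barycenter w) (subdiv (boundary (of w)))

/-- The chain homotopy between the identity and barycentric subdivision. -/
def homotopy : ∀ {m : ℕ}, AffineChain m n →ₗ[ℤ] AffineChain (m + 1) n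
  | 0 => 0
  | _ + 1 => lift fun w => cone (barycenter w) (of w - homotopy (boundary (of w)))

lemma subdiv_of (w : Fin (m + 1) → TopSimplex n) :
    subdiv (of w) = cone (barycenter w) (subdiv (boundary (of w))) := by
  rw [subdiv, lift_of]

lemma homotopy_of (w : Fin (m + 1) → TopSimplex n) :
    homotopy (of w) = cone (barycenter w) (of w - homotopy (boundary (of w))) := by
  rw [homotopy, lift_of]

lemma boundary_subdiv (x : AffineChain (m + 1) n) :
    boundary (subdiv x) = subdiv (boundary x) := by
  suffices h : boundary ∘ₗ subdiv = subdiv ∘ₗ (boundary (m := m) (n := n)) from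
    LinearMap.congr_fun h x
  clear x
  ext1 w
  simp only [LinearMap.comp_apply]
  induction m with
  | zero => rw [subdiv_of, boundary_cone_zero]
  | succ m ih =>
    have := LinearMap.congr_fun (hom_ext (f := boundary ∘ₗ subdiv) (g := subdiv ∘ₗ boundary) ih)
    simp only [LinearMap.comp_apply] at this
    rw [subdiv_of, boundary_cone, this, boundary_boundary, map_zero, map_zero, sub_zero]

lemma boundary_homotopy_zero (x : AffineChain 0 n) : boundary (homotopy x) = 0 := by
  simp [homotopy]

/-- The homotopy formula `∂ h + h ∂ = 1 - sd`. -/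
lemma boundary_homotopy (x : AffineChain (m + 1) n) :
    boundary (homotopy x) = x - subdiv x - homotopy (boundary x) := by
  suffices h : boundary ∘ₗ homotopy =
      LinearMap.id - subdiv - homotopy ∘ₗ (boundary (m := m) (n := n)) from
    LinearMap.congr_fun h x
  clear x
  ext1 w
  simp only [LinearMap.comp_apply, LinearMap.sub_apply, LinearMap.id_apply]
  induction m with
  | zero =>
    have : boundary (of w - homotopy (boundary (of w))) = subdiv (boundary (of w)) := by
      rw [map_sub, boundary_homotopy_zero, sub_zero]; rfl
    rw [homotopy_of, boundary_cone, this, subdiv_of]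
    abel
  | succ m ih =>
    have := LinearMap.congr_fun (hom_ext (f := boundary ∘ₗ homotopy)
      (g := LinearMap.id - subdiv - homotopy ∘ₗ boundary) ih)
    simp only [LinearMap.comp_apply, LinearMap.sub_apply, LinearMap.id_apply] at this
    rw [homotopy_of, boundary_cone, map_sub, this, boundary_boundary, map_zero, sub_zero,
      sub_sub_cancel, ← subdiv_of]
    abel

lemma push_subdiv (v : Fin (n + 1) → TopSimplex k) (x : AffineChain m n) :
    push v (subdiv x) = subdiv (push v x) := by
  suffices h : push v ∘ₗ subdiv = subdiv ∘ₗ (push (m := m) v) from LinearMap.congr_fun h x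
  clear x
  ext1 w
  simp only [LinearMap.comp_apply]
  induction m with
  | zero => rfl
  | succ m ih =>
    have := LinearMap.congr_fun (hom_ext (f := push v ∘ₗ subdiv) (g := subdiv ∘ₗ push v) ih)
    simp only [LinearMap.comp_apply] at this
    rw [subdiv_of, push_cone, this, push_boundary, affineMap_barycenter, push_of, subdiv_of]

lemma push_homotopy (v : Fin (n + 1) → TopSimplex k) (x : AffineChain m n) :
    push v (homotopy x) = homotopy (push v x) := by
  suffices h : push v ∘ₗ homotopy = homotopy ∘ₗ (push (m := m) v) from LinearMap.congr_fun h x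
  clear x
  ext1 w
  simp only [LinearMap.comp_apply]
  induction m with
  | zero => simp [homotopy]
  | succ m ih =>
    have := LinearMap.congr_fun (hom_ext (f := push v ∘ₗ homotopy) (g := homotopy ∘ₗ push v) ih)
    simp only [LinearMap.comp_apply] at this
    rw [homotopy_of, push_cone, map_sub, this, push_boundary, affineMap_barycenter, push_of,
      homotopy_of]

/-! ### The mesh of the barycentric subdivision -/

/-- The submodule of chains all of whose simplices satisfy `P`. -/
abbrev supportedIn (P : (Fin m → TopSimplex n) → Prop) : Submodule ℤ (AffineChain m n) :=
  Finsupp.supported ℤ ℤ {w | P w}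

lemma of_mem {P : (Fin m → TopSimplex n) → Prop} {w : Fin m → TopSimplex n} (h : P w) :
    of w ∈ supportedIn P :=
  Finsupp.single_mem_supported ℤ _ h

lemma map_mem_supportedIn {l : ℕ} {P : (Fin m → TopSimplex n) → Prop}
    {Q : (Fin l → TopSimplex k) → Prop} (f : AffineChain m n →ₗ[ℤ] AffineChain l k)
    (h : ∀ w, P w → f (of w) ∈ supportedIn Q) {x : AffineChain m n} (hx : x ∈ supportedIn P) :
    f x ∈ supportedIn Q := by
  rw [supportedIn, Finsupp.supported_eq_span_single] at hx
  have : Submodule.span ℤ ((fun i => Finsupp.single i (1 : ℤ)) '' {w | P w}) ≤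
      (supportedIn Q).comap f := by
    rw [Submodule.span_le]
    rintro _ ⟨w, hw, rfl⟩
    exact h w hw
  exact this hx

/-- The vertices of `w` lie in `C` and have mutual distances at most `D`. The distances are those of
the sup norm on the coordinates. -/
def IsSmall (C : Set (Fin (n + 1) → ℝ)) (D : ℝ) (w : Fin m → TopSimplex n) : Prop :=
  (∀ i, (w i).1 ∈ C) ∧ ∀ i j, dist (w i) (w j) ≤ D

lemma dist_affineMap_le {w : Fin (m + 1) → TopSimplex n} {D : ℝ} {y : TopSimplex n}
    (h : ∀ i, dist (w i) y ≤ D) (t : TopSimplex m) : dist (affineMap w t) y ≤ D := by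
  have := (convex_closedBall y.1 D).sum_mem (t := Finset.univ) (w := t.1)
    (z := fun i => (w i).1) (fun i _ => t.2.1 i) t.2.2 (fun i _ => h i)
  exact this

/-- The difference between the barycenter and `w i` is the mean of the `m + 1` differences
`w j - w i`, one of which is zero. -/
lemma dist_barycenter_le {w : Fin (m + 1) → TopSimplex n} {D : ℝ}
    (h : ∀ i j, dist (w i) (w j) ≤ D) (i : Fin (m + 1)) :
    dist (barycenter w) (w i) ≤ m / (m + 1) * D := by
  have e : (barycenter w).1 - (w i).1 = ∑ j ∈ Finset.univ.erase i,
      (m + 1 : ℝ)⁻¹ • ((w j).1 - (w i).1) := by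
    rw [Finset.sum_erase _ (by simp)]
    simp only [smul_sub, Finset.sum_sub_distrib, Finset.sum_const, Finset.card_univ,
      Fintype.card_fin, barycenter, affineMap, stdSimplex.barycenter_apply, ContinuousMap.coe_mk]
    rw [← Nat.cast_smul_eq_nsmul ℝ, smul_smul, Nat.cast_add, Nat.cast_one, mul_inv_cancel₀
      (by positivity), one_smul]
  have hd : dist (barycenter w) (w i) = ‖(barycenter w).1 - (w i).1‖ := by
    rw [← dist_eq_norm]; rfl
  rw [hd, e]
  refine (norm_sum_le_of_le _ (f := fun j => (m + 1 : ℝ)⁻¹ • ((w j).1 - (w i).1))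
    (n := fun _ => (m + 1 : ℝ)⁻¹ * D) fun j _ => ?_).trans ?_
  · rw [norm_smul, Real.norm_of_nonneg (by positivity), ← dist_eq_norm]
    exact mul_le_mul_of_nonneg_left (h j i) (by positivity)
  · rw [Finset.sum_const, Finset.card_erase_of_mem (Finset.mem_univ _), Finset.card_univ,
      Fintype.card_fin, nsmul_eq_mul, Nat.add_sub_cancel]
    apply le_of_eq; ring

/-- Barycentric subdivision shrinks the distances between the vertices of a simplex of dimension
at most `N` by the factor `N / (N + 1)`. The convex set `C` is there for the induction on the
dimension: the boundary is contained in a ball around the barycenter, hence so is its subdivision,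
and this bounds the distances from the new vertex. -/
lemma subdiv_mem {C : Set (Fin (n + 1) → ℝ)} (hC : Convex ℝ C) {D : ℝ} (N : ℕ)
    (hm : m ≤ N + 1) (hD : 0 ≤ D) {x : AffineChain m n} (hx : x ∈ supportedIn (IsSmall C D)) :
    subdiv x ∈ supportedIn (IsSmall C (N / (N + 1) * D)) := by
  refine map_mem_supportedIn _ (fun w hw => ?_) hx
  clear hx x
  induction m generalizing C with
  | zero => exact of_mem ⟨fun i => i.elim0, fun i => i.elim0⟩
  | succ m ih =>
    set D' : ℝ := N / (N + 1) * D
    have hD' : 0 ≤ D' := by positivity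
    have hb : ∀ i, dist (w i) (barycenter w) ≤ D' := fun i => by
      rw [dist_comm]
      refine (dist_barycenter_le hw.2 i).trans (mul_le_mul_of_nonneg_right ?_ hD)
      rw [div_le_div_iff₀ (by positivity) (by positivity)]
      have : (m : ℝ) ≤ N := by exact_mod_cast (by lia : m ≤ N)
      nlinarith
    have hbC : (barycenter w).1 ∈ C :=
      hC.sum_mem (fun i _ => (stdSimplex.barycenter (𝕜 := ℝ) (X := Fin (m + 1))).2.1 i)
        (stdSimplex.barycenter (𝕜 := ℝ) (X := Fin (m + 1))).2.2 (fun i _ => hw.1 i)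
    rw [subdiv_of]
    have hB : boundary (of w) ∈
        supportedIn (IsSmall (C ∩ Metric.closedBall (barycenter w).1 D') D) := by
      rw [boundary_of]
      refine Submodule.sum_mem _ fun i _ => Submodule.smul_mem _ _ (of_mem ⟨fun j => ⟨hw.1 _, ?_⟩,
        fun j j' => hw.2 _ _⟩)
      exact hb _
    have hS := map_mem_supportedIn subdiv (fun w' hw' => ih (hC.inter (convex_closedBall _ _))
      (by lia) w' hw') hB
    refine map_mem_supportedIn _ (fun w' hw' => ?_) hS
    rw [cone_of]
    refine of_mem ⟨fun i => ?_, fun i j => ?_⟩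
    · induction i using Fin.cases with
      | zero => exact hbC
      | succ i => exact (hw'.1 i).1
    · induction i using Fin.cases with
      | zero =>
        induction j using Fin.cases with
        | zero => simpa using hD'
        | succ j =>
          rw [dist_comm]
          exact (hw'.1 j).2
      | succ i =>
        induction j using Fin.cases with
        | zero => exact (hw'.1 i).2
        | succ j => exact hw'.2 i j

lemma subdiv_pow_mem {D : ℝ} (hD : 0 ≤ D) (k : ℕ) {x : AffineChain (m + 1) n}
    (hx : x ∈ supportedIn (IsSmall Set.univ D)) :
    subdiv^[k] x ∈ supportedIn (IsSmall Set.univ ((m / (m + 1) : ℝ) ^ k * D)) := by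
  induction k with
  | zero => simpa using hx
  | succ k ih =>
    rw [Function.iterate_succ_apply', pow_succ', mul_assoc]
    exact subdiv_mem convex_univ m le_rfl (by positivity) ih

end AffineChain

/-! ### A criterion for quasi-isomorphisms -/

section

variable {ι : Type*} {c : ComplexShape ι}

/-- A power of a map homotopic to the identity does not change homology classes. -/
lemma homologyMap_iterate {D : HomologicalComplex AddCommGrpCat.{u} c} {s : D ⟶ D}
    (h : Homotopy s (𝟙 D)) (n : ι) (k : ℕ) (z : D.cycles n) :
    D.homologyπ n ((HomologicalComplex.cyclesMap s n)^[k] z) = D.homologyπ n z := by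
  induction k with
  | zero => rfl
  | succ k ih =>
    rw [Function.iterate_succ_apply', ← ConcreteCategory.comp_apply,
      ← HomologicalComplex.homologyπ_naturality, h.homologyMap_eq,
      HomologicalComplex.homologyMap_id, Category.comp_id, ih]

/-- A degreewise injective chain map `j : K ⟶ L` is a quasi-isomorphism if some endomorphism `s`
of `L` which is homotopic to the identity restricts to such an endomorphism of `K`, and a
suitable power of `s` moves any given chain of `L` into `K`. -/
lemma quasiIso_of_iterate {K L : HomologicalComplex AddCommGrpCat.{u} c} (j : K ⟶ L)
    [∀ n, Mono (j.f n)] (s : L ⟶ L) (hs : Homotopy s (𝟙 L)) (t : K ⟶ K) (ht : Homotopy t (𝟙 K))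
    (comm : t ≫ j = j ≫ s) (h : ∀ n (x : L.X n), ∃ (k : ℕ) (y : K.X n), (s.f n)^[k] x = j.f n y) :
    QuasiIso j where
  quasiIsoAt n := by
    rw [quasiIsoAt_iff_isIso_homologyMap]
    have hinj : ∀ m, Function.Injective (j.f m) := fun m =>
      (AddCommGrpCat.mono_iff_injective _).1 inferInstance
    have hi (M : HomologicalComplex AddCommGrpCat.{u} c) (m : ι) :
        Function.Injective (M.iCycles m) := (AddCommGrpCat.mono_iff_injective _).1 inferInstance
    have hπ (M : HomologicalComplex AddCommGrpCat.{u} c) (m : ι) :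
        Function.Surjective (M.homologyπ m) := (AddCommGrpCat.epi_iff_surjective _).1 inferInstance
    have hcyc (M N : HomologicalComplex AddCommGrpCat.{u} c) (f : M ⟶ N) (z : M.cycles n) :
        N.iCycles n (HomologicalComplex.cyclesMap f n z) = f.f n (M.iCycles n z) := by
      rw [← ConcreteCategory.comp_apply, ← ConcreteCategory.comp_apply,
        HomologicalComplex.cyclesMap_i]
    have htc (M : HomologicalComplex AddCommGrpCat.{u} c) (x : M.X (c.prev n)) :
        M.iCycles n (M.toCycles (c.prev n) n x) = M.d (c.prev n) n x := by
      rw [← ConcreteCategory.comp_apply, HomologicalComplex.toCycles_i]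
    have hsc (k : ℕ) (z : L.cycles n) :
        L.iCycles n ((HomologicalComplex.cyclesMap s n)^[k] z) = (s.f n)^[k] (L.iCycles n z) :=
      Function.Semiconj.iterate_right (f := L.iCycles n)
        (ga := HomologicalComplex.cyclesMap s n) (gb := s.f n) (fun z => hcyc _ _ s z) k z
    have htj (k : ℕ) (z : K.cycles n) : HomologicalComplex.cyclesMap j n
        ((HomologicalComplex.cyclesMap t n)^[k] z) =
          (HomologicalComplex.cyclesMap s n)^[k] (HomologicalComplex.cyclesMap j n z) := by
      refine Function.Semiconj.iterate_right (f := HomologicalComplex.cyclesMap j n)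
        (ga := HomologicalComplex.cyclesMap t n) (gb := HomologicalComplex.cyclesMap s n)
        (fun z => ?_) k z
      rw [← ConcreteCategory.comp_apply, ← ConcreteCategory.comp_apply,
        ← HomologicalComplex.cyclesMap_comp, ← HomologicalComplex.cyclesMap_comp, comm]
    have hstd (k : ℕ) (x : L.X (c.prev n)) :
        L.toCycles (c.prev n) n ((s.f _)^[k] x) =
          (HomologicalComplex.cyclesMap s n)^[k] (L.toCycles (c.prev n) n x) := by
      refine Function.Semiconj.iterate_right (f := L.toCycles (c.prev n) n)
        (ga := s.f _) (gb := HomologicalComplex.cyclesMap s n) (fun x => hi _ _ ?_) k x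
      rw [hcyc, htc, htc, ← ConcreteCategory.comp_apply, HomologicalComplex.Hom.comm]
      rfl
    have hex (M : HomologicalComplex AddCommGrpCat.{u} c) (z : M.cycles n)
        (hz : M.homologyπ n z = 0) : ∃ x, M.toCycles (c.prev n) n x = z := by
      have : (ShortComplex.mk (M.toCycles (c.prev n) n) (M.homologyπ n) (by simp)).Exact :=
        ShortComplex.exact_of_g_is_cokernel _ (M.homologyIsCokernel (c.prev n) n rfl)
      exact (ShortComplex.ab_exact_iff _).1 this z hz
    have hnat (z : K.cycles n) : HomologicalComplex.homologyMap j n (K.homologyπ n z) =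
        L.homologyπ n (HomologicalComplex.cyclesMap j n z) := by
      rw [← ConcreteCategory.comp_apply, ← ConcreteCategory.comp_apply,
        HomologicalComplex.homologyπ_naturality]
    have hlift (z : L.cycles n) (y : K.X n) (hy : j.f n y = L.iCycles n z) :
        ∃ z' : K.cycles n, HomologicalComplex.cyclesMap j n z' = z := by
      have hK : (ShortComplex.mk (K.iCycles n) (K.d n (c.next n)) (by simp)).Exact :=
        ShortComplex.exact_of_f_is_kernel _ (K.cyclesIsKernel n (c.next n) rfl)
      obtain ⟨z', hz'⟩ := (ShortComplex.ab_exact_iff _).1 hK y (hinj _ (by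
        change j.f _ (K.d n (c.next n) y) = _
        rw [← ConcreteCategory.comp_apply, ← HomologicalComplex.Hom.comm,
          ConcreteCategory.comp_apply, hy, ← ConcreteCategory.comp_apply,
          HomologicalComplex.iCycles_d, map_zero]
        rfl))
      refine ⟨z', hi _ _ ?_⟩
      rw [hcyc, ← hy]
      exact congrArg _ hz'
    -- if `j z` is the boundary of `b`, then `t^k z` is the boundary of a preimage of `s^k b`
    have : Mono (HomologicalComplex.homologyMap j n) := by
      rw [AddCommGrpCat.mono_iff_injective, injective_iff_map_eq_zero]
      intro x hx
      obtain ⟨z, rfl⟩ := hπ _ _ x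
      rw [hnat] at hx
      obtain ⟨b, hb⟩ := hex _ _ hx
      obtain ⟨k, y, hy⟩ := h _ b
      rw [← homologyMap_iterate ht n k]
      have : (HomologicalComplex.cyclesMap t n)^[k] z = K.toCycles (c.prev n) n y := by
        apply (AddCommGrpCat.mono_iff_injective (HomologicalComplex.cyclesMap j n)).1
          (mono_of_mono_fac (HomologicalComplex.cyclesMap_i j n))
        rw [htj, ← hb, ← hstd, hy]
        apply hi
        rw [hcyc, htc, htc, ← ConcreteCategory.comp_apply, HomologicalComplex.Hom.comm]
        rfl
      rw [this, ← ConcreteCategory.comp_apply, HomologicalComplex.toCycles_comp_homologyπ]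
      rfl
    -- a cycle `z` of `L` is homologous to `s^k z`, which is in the image of `K`
    have : Epi (HomologicalComplex.homologyMap j n) := by
      rw [AddCommGrpCat.epi_iff_surjective]
      intro x
      obtain ⟨z, rfl⟩ := hπ _ _ x
      obtain ⟨k, y, hy⟩ := h n (L.iCycles n z)
      obtain ⟨z', hz'⟩ := hlift ((HomologicalComplex.cyclesMap s n)^[k] z) y (by rw [hsc, hy])
      exact ⟨K.homologyπ n z', by rw [hnat, hz', homologyMap_iterate hs]⟩
    exact isIso_of_mono_of_epi _

end

/-! ### Subdivision of singular chains -/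

open Simplicial Opposite

/-- A right action of affine maps between standard simplices on a simplicial set, such that faces
are given by restriction to the affine faces. Such an action suffices to define barycentric
subdivision; the singular simplices of a space and those which are small with respect to a cover are
the two examples. -/
structure AffineAction (K : SSet.{w}) where
  /-- the restriction of a simplex along the affine map with vertices `v` -/
  act {m n : ℕ} (x : K _⦋n⦌) (v : Fin (m + 1) → TopSimplex n) : K _⦋m⦌
  act_stdVertex {n : ℕ} (x : K _⦋n⦌) : act x (stdVertex n) = x
  act_act {k m n : ℕ} (x : K _⦋n⦌) (v : Fin (m + 1) → TopSimplex n)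
    (w : Fin (k + 1) → TopSimplex m) : act (act x v) w = act x (affineMap v ∘ w)
  δ_eq {n : ℕ} (x : K _⦋n + 1⦌) (i : Fin (n + 2)) :
    K.δ i x = act x (stdVertex (n + 1) ∘ i.succAbove)

section

variable (K : SSet.{w}) {C : Type*} [Category* C] [HasCoproducts.{w} C] [Preadditive C] {A : C}

/-- The morphism from the simplicial chains given by a family of morphisms. -/
def chainDesc {n : ℕ} {T : C} (f : K _⦋n⦌ → (A ⟶ T)) : (K.chainComplex A).X n ⟶ T :=
  (K.isColimitChainComplexXCofan A n).desc (Cofan.mk T f)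

@[simp]
lemma ι_chainDesc {n : ℕ} {T : C} (f : K _⦋n⦌ → (A ⟶ T)) (x : K _⦋n⦌) :
    K.ιChainComplex x ≫ chainDesc K f = f x :=
  (K.isColimitChainComplexXCofan A n).fac (Cofan.mk T f) ⟨x⟩

end

namespace AffineAction

variable {K : SSet.{w}} (a : AffineAction K)

lemma δ_act {m n : ℕ} (x : K _⦋n⦌) (v : Fin (m + 2) → TopSimplex n) (i : Fin (m + 2)) :
    K.δ i (a.act x v) = a.act x (v ∘ i.succAbove) := by
  rw [δ_eq, act_act]
  congr 1
  ext1 j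
  exact affineMap_vertex v _

variable {C : Type*} [Category* C] [Preadditive C] (A : C)

/-- Composition with a morphism, as a linear map. -/
def postcomp {T T' : C} (g : T ⟶ T') : (A ⟶ T) →ₗ[ℤ] (A ⟶ T') :=
  (Preadditive.rightComp A g).toIntLinearMap

@[simp]
lemma postcomp_apply {T T' : C} (f : A ⟶ T) (g : T ⟶ T') : postcomp A g f = f ≫ g := rfl

variable [HasCoproducts.{w} C]

/-- The restrictions of a simplex along an affine chain, as a linear combination of inclusions of
summands `A` of the chain group. -/
def restrict {m n : ℕ} (x : K _⦋n⦌) : AffineChain (m + 1) n →ₗ[ℤ] (A ⟶ (K.chainComplex A).X m) :=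
  AffineChain.lift fun v => K.ιChainComplex (a.act x v)

@[simp]
lemma restrict_of {m n : ℕ} (x : K _⦋n⦌) (v : Fin (m + 1) → TopSimplex n) :
    a.restrict A x (.of v) = K.ιChainComplex (a.act x v) :=
  AffineChain.lift_of _ _

lemma restrict_stdVertex {n : ℕ} (x : K _⦋n⦌) :
    a.restrict A x (.of (stdVertex n)) = K.ιChainComplex x := by
  rw [restrict_of, act_stdVertex]

lemma restrict_d {m n : ℕ} (x : K _⦋n⦌) (y : AffineChain (m + 2) n) :
    a.restrict A x y ≫ (K.chainComplex A).d (m + 1) m = a.restrict A x (.boundary y) := by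
  suffices h : postcomp A ((K.chainComplex A).d (m + 1) m) ∘ₗ a.restrict A x =
    a.restrict A x ∘ₗ AffineChain.boundary from LinearMap.congr_fun h y
  ext1 v
  simp only [LinearMap.comp_apply, restrict_of, postcomp_apply, SSet.ιChainComplex_d,
    AffineChain.boundary_of, map_sum, map_smul, δ_act]

lemma restrict_act {k m n : ℕ} (x : K _⦋n⦌) (v : Fin (m + 1) → TopSimplex n)
    (y : AffineChain (k + 1) m) :
    a.restrict A (a.act x v) y = a.restrict A x (.push v y) := by
  suffices h : a.restrict A (a.act x v) = a.restrict A x ∘ₗ AffineChain.push v from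
    LinearMap.congr_fun h y
  ext1 w
  simp [act_act]

/-- Barycentric subdivision, in each degree. -/
def subdivX (n : ℕ) : (K.chainComplex A).X n ⟶ (K.chainComplex A).X n :=
  chainDesc K fun x => a.restrict A x (.subdiv (.of (stdVertex n)))

/-- The homotopy between barycentric subdivision and the identity, in each degree. -/
def homotopyX (n : ℕ) : (K.chainComplex A).X n ⟶ (K.chainComplex A).X (n + 1) :=
  chainDesc K fun x => a.restrict A x (.homotopy (.of (stdVertex n)))

lemma push_stdVertex {m n : ℕ} (v : Fin (m + 1) → TopSimplex n) :
    AffineChain.push v (.of (stdVertex m)) = .of v := by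
  rw [AffineChain.push_of]
  congr 1
  ext1 i
  exact affineMap_vertex v i

lemma restrict_subdivX {m n : ℕ} (x : K _⦋n⦌) (y : AffineChain (m + 1) n) :
    a.restrict A x y ≫ a.subdivX A m = a.restrict A x (.subdiv y) := by
  suffices h : postcomp A (a.subdivX A m) ∘ₗ a.restrict A x =
    a.restrict A x ∘ₗ AffineChain.subdiv from LinearMap.congr_fun h y
  ext1 v
  simp only [LinearMap.comp_apply, restrict_of, postcomp_apply, subdivX, ι_chainDesc, restrict_act,
    AffineChain.push_subdiv, push_stdVertex]

lemma restrict_homotopyX {m n : ℕ} (x : K _⦋n⦌) (y : AffineChain (m + 1) n) :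
    a.restrict A x y ≫ a.homotopyX A m = a.restrict A x (.homotopy y) := by
  suffices h : postcomp A (a.homotopyX A m) ∘ₗ a.restrict A x =
    a.restrict A x ∘ₗ AffineChain.homotopy from LinearMap.congr_fun h y
  ext1 v
  simp only [LinearMap.comp_apply, restrict_of, postcomp_apply, homotopyX, ι_chainDesc,
    restrict_act, AffineChain.push_homotopy, push_stdVertex]

/-- Barycentric subdivision, as a chain map. -/
def subdivMap : K.chainComplex A ⟶ K.chainComplex A where
  f n := a.subdivX A n
  comm' i j h := by
    obtain rfl : j + 1 = i := h
    ext x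
    rw [← a.restrict_stdVertex, ← Category.assoc, ← Category.assoc, restrict_subdivX, restrict_d,
      restrict_d, restrict_subdivX, AffineChain.boundary_subdiv]

/-- Barycentric subdivision is homotopic to the identity. The sign is due to the direction of the
homotopy. -/
def subdivHomotopy : Homotopy (a.subdivMap A) (𝟙 (K.chainComplex A)) where
  hom i j := if h : i + 1 = j then - a.homotopyX A i ≫ eqToHom (by rw [h]) else 0
  zero i j h := dif_neg h
  comm n := by
    ext x
    rw [Homotopy.prevD_chainComplex, dif_pos rfl, eqToHom_refl, Category.comp_id]
    cases n with
    | zero =>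
      rw [Homotopy.dNext_zero_chainComplex, ← a.restrict_stdVertex]
      simp only [Preadditive.comp_add, Preadditive.neg_comp, Preadditive.comp_neg,
        zero_add, HomologicalComplex.id_f, Category.comp_id]
      rw [← Category.assoc, restrict_homotopyX, restrict_d, AffineChain.boundary_homotopy,
        subdivMap, restrict_subdivX]
      simp only [map_sub, AffineChain.homotopy, LinearMap.zero_apply, sub_zero]
      abel
    | succ n =>
      rw [Homotopy.dNext_succ_chainComplex, dif_pos rfl, eqToHom_refl, Category.comp_id,
        ← a.restrict_stdVertex]
      simp only [Preadditive.comp_add, Preadditive.neg_comp, Preadditive.comp_neg,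
        HomologicalComplex.id_f, Category.comp_id]
      rw [← Category.assoc, ← Category.assoc, restrict_homotopyX, restrict_d, restrict_d,
        restrict_homotopyX, AffineChain.boundary_homotopy, subdivMap, restrict_subdivX]
      simp only [map_sub]
      abel

variable {L : SSet.{w}} (b : AffineAction L)

lemma subdivMap_naturality (f : K ⟶ L)
    (h : ∀ {m n : ℕ} (x : K _⦋n⦌) (v : Fin (m + 1) → TopSimplex n),
      f.app _ (a.act x v) = b.act (f.app _ x) v) :
    a.subdivMap A ≫ SSet.chainComplexMap f A = SSet.chainComplexMap f A ≫ b.subdivMap A := by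
  have key {m n : ℕ} (x : K _⦋n⦌) (y : AffineChain (m + 1) n) :
      a.restrict A x y ≫ (SSet.chainComplexMap f A).f m = b.restrict A (f.app _ x) y := by
    suffices h' : postcomp A ((SSet.chainComplexMap f A).f m) ∘ₗ a.restrict A x =
      b.restrict A (f.app _ x) from LinearMap.congr_fun h' y
    ext1 v
    simp [h]
  ext n x
  simp only [HomologicalComplex.comp_f]
  rw [← a.restrict_stdVertex, ← Category.assoc, ← Category.assoc, key]
  simp only [subdivMap]
  rw [restrict_subdivX, restrict_subdivX, key]

end AffineAction

/-- The action of affine maps on the singular simplices of a space. -/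
def singularAction (X : TopCat.{w}) : AffineAction (TopCat.toSSet.obj X) where
  act x v := (X.toSSetObjEquiv _).symm ((X.toSSetObjEquiv (op ⦋_⦌) x).comp (affineMap v))
  act_stdVertex x := by
    rw [affineMap_stdVertex]
    exact (X.toSSetObjEquiv _).symm_apply_apply x
  act_act x v w := by
    rw [affineMap_comp]
    congr 1
  δ_eq {n} x i := by
    apply (X.toSSetObjEquiv _).injective
    erw [Equiv.apply_symm_apply]
    ext t
    change _ = X.toSSetObjEquiv (op ⦋n + 1⦌) x _
    have : affineMap (stdVertex (n + 1) ∘ i.succAbove) t = stdSimplex.map i.succAbove t := by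
      apply Subtype.ext
      funext j
      change (∑ k, t.1 k • Pi.single (i.succAbove k) (1 : ℝ) : Fin (n + 2) → ℝ) j =
        FunOnFinite.linearMap ℝ ℝ i.succAbove t.1 j
      simp [FunOnFinite.linearMap_apply_apply, Pi.single_apply, Finset.sum_filter, eq_comm]
    rw [this]
    rfl

/-- The simplicial set of those singular simplices which are contained in a member of the family
`𝒰`. -/
def smallSimplices (X : TopCat.{w}) {ι : Type*} (𝒰 : ι → Set X) :
    (TopCat.toSSet.obj X).Subcomplex where
  obj n := {σ | ∃ i, Set.range (X.toSSetObjEquiv n σ) ⊆ 𝒰 i}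
  map f := by
    rintro σ ⟨i, hi⟩
    refine ⟨i, subset_trans ?_ hi⟩
    rintro _ ⟨t, rfl⟩
    exact ⟨(SimplexCategory.toTop₀.map f.unop) t, rfl⟩

/-- The action of affine maps on small singular simplices. -/
def smallAction (X : TopCat.{w}) {ι : Type*} (𝒰 : ι → Set X) :
    AffineAction (smallSimplices X 𝒰 : SSet.{w}) where
  act x v := ⟨(singularAction X).act x.1 v, by
    obtain ⟨i, hi⟩ := x.2
    refine ⟨i, subset_trans ?_ hi⟩
    rintro _ ⟨t, rfl⟩
    exact ⟨affineMap v t, rfl⟩⟩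
  act_stdVertex x := Subtype.ext ((singularAction X).act_stdVertex x.1)
  act_act x v w := Subtype.ext ((singularAction X).act_act x.1 v w)
  δ_eq x i := Subtype.ext ((singularAction X).δ_eq x.1 i)

/-- An injective map of simplicial sets induces a split monomorphism of chain groups: map the
simplices outside the image to zero. -/
lemma mono_chainComplexMap_f {K L : SSet.{w}} (f : K ⟶ L) {C : Type*} [Category* C]
    [HasCoproducts.{w} C] [Preadditive C] (A : C) (n : ℕ)
    (hf : Function.Injective (f.app (op ⦋n⦌))) : Mono ((SSet.chainComplexMap f A).f n) := by
  classical
  let r : (L.chainComplex A).X n ⟶ (K.chainComplex A).X n := chainDesc L fun y =>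
    if h : ∃ x, f.app (op ⦋n⦌) x = y then K.ιChainComplex h.choose else 0
  have : (SSet.chainComplexMap f A).f n ≫ r = 𝟙 _ := by
    ext x
    have h : ∃ x', f.app (op ⦋n⦌) x' = f.app (op ⦋n⦌) x := ⟨x, rfl⟩
    rw [SSet.ι_chainComplexMap_f_assoc, ι_chainDesc, dif_pos h, hf h.choose_spec,
      Category.comp_id]
  exact mono_of_mono_fac this

/-- The chain group is generated by the simplices with coefficients in `A`. -/
lemma addSubgroup_eq_top {K : SSet.{w}} [HasCoproducts.{w} AddCommGrpCat.{u}]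
    {A : AddCommGrpCat.{u}} {n : ℕ} (N : AddSubgroup ((K.chainComplex A).X n))
    (h : ∀ (x : K _⦋n⦌) (a : A), K.ιChainComplex (R := A) x a ∈ N) : N = ⊤ := by
  let q : (K.chainComplex A).X n ⟶ AddCommGrpCat.of (_ ⧸ N) :=
    AddCommGrpCat.ofHom (QuotientAddGroup.mk' N)
  have hq : q = 0 := by
    refine SSet.chainComplex_hom_ext fun x => ?_
    ext a
    exact (QuotientAddGroup.eq_zero_iff _).2 (h x a)
  rw [eq_top_iff]
  intro x _
  rw [← QuotientAddGroup.eq_zero_iff]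
  exact ConcreteCategory.congr_hom hq x

lemma restrict_subdiv_iterate {K : SSet.{w}} [HasCoproducts.{w} AddCommGrpCat.{u}]
    (a : AffineAction K) (A : AddCommGrpCat.{u}) {n : ℕ} (x : K _⦋n⦌) (k : ℕ) (c : A) :
    ((a.subdivMap A).f n)^[k] (K.ιChainComplex (R := A) x c) =
      a.restrict A x (AffineChain.subdiv^[k] (.of (stdVertex n))) c := by
  induction k with
  | zero => rw [Function.iterate_zero_apply, Function.iterate_zero_apply, a.restrict_stdVertex]
  | succ k ih =>
    rw [Function.iterate_succ_apply', ih, Function.iterate_succ_apply', ← a.restrict_subdivX]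
    rfl

/-- Some iterated subdivision of a singular simplex is small with respect to an open cover, by
Lebesgue's lemma. -/
lemma exists_isSmall (X : TopCat.{w}) {ι : Type*} (𝒰 : ι → Set X) (hU : ∀ i, IsOpen (𝒰 i))
    (hX : ⋃ i, 𝒰 i = Set.univ) {n : ℕ} (σ : TopCat.toSSet.obj X _⦋n⦌) :
    ∃ k, AffineChain.subdiv^[k] (.of (stdVertex n)) ∈ AffineChain.supportedIn
      fun v => (singularAction X).act σ v ∈ (smallSimplices X 𝒰).obj (op ⦋n⦌) := by
  let s : C(TopSimplex n, X) := X.toSSetObjEquiv (op ⦋n⦌) σ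
  obtain ⟨δ, hδ, h⟩ := lebesgue_number_lemma_of_metric (s := (Set.univ : Set (TopSimplex n)))
    (c := fun i => s ⁻¹' 𝒰 i) isCompact_univ (fun i => (hU i).preimage s.continuous) (by
      rw [← Set.preimage_iUnion, hX, Set.preimage_univ])
  obtain ⟨k, hk⟩ : ∃ k : ℕ, ((n / (n + 1) : ℝ)) ^ k * Metric.diam (Set.univ : Set (TopSimplex n))
      < δ := by
    have h1 : Filter.Tendsto (fun k : ℕ => ((n / (n + 1) : ℝ)) ^ k *
        Metric.diam (Set.univ : Set (TopSimplex n))) Filter.atTop (𝓝 (0 * _)) :=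
      (tendsto_pow_atTop_nhds_zero_of_lt_one (by positivity)
        (by rw [div_lt_one (by positivity)]; linarith)).mul_const _
    rw [zero_mul] at h1
    exact (h1.eventually_lt_const hδ).exists
  refine ⟨k, Finsupp.supported_mono ?_ (AffineChain.subdiv_pow_mem Metric.diam_nonneg k
    (AffineChain.of_mem ⟨fun _ => Set.mem_univ _, fun i j => Metric.dist_le_diam_of_mem
      isCompact_univ.isBounded (Set.mem_univ _) (Set.mem_univ _)⟩))⟩
  intro v hv
  obtain ⟨i, hi⟩ := h (v 0) (Set.mem_univ _)
  refine ⟨i, ?_⟩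
  rintro _ ⟨t, rfl⟩
  refine hi (Metric.mem_ball.2 (lt_of_le_of_lt ?_ hk) : affineMap v t ∈ _)
  exact AffineChain.dist_affineMap_le (fun j => hv.2 j 0) t

/-- Small singular chains compute singular homology. -/
theorem quasiIso_smallSimplices (X : TopCat.{w}) {ι : Type*} (𝒰 : ι → Set X)
    (hU : ∀ i, IsOpen (𝒰 i)) (hX : ⋃ i, 𝒰 i = Set.univ) [HasCoproducts.{w} AddCommGrpCat.{u}]
    (A : AddCommGrpCat.{u}) : QuasiIso (SSet.chainComplexMap (smallSimplices X 𝒰).ι A) := by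
  have hmono : ∀ n, Mono ((SSet.chainComplexMap (smallSimplices X 𝒰).ι A).f n) := fun n =>
    mono_chainComplexMap_f _ A n Subtype.val_injective
  have comm := (smallAction X 𝒰).subdivMap_naturality A (singularAction X) (smallSimplices X 𝒰).ι
    (fun _ _ => rfl)
  refine quasiIso_of_iterate _ ((singularAction X).subdivMap A)
    ((singularAction X).subdivHomotopy A) ((smallAction X 𝒰).subdivMap A)
    ((smallAction X 𝒰).subdivHomotopy A) comm fun n x => ?_
  -- further subdivisions of a small chain are small, so that exponents can be made equal in sums
  have step (x) (k l : ℕ) (h : ∃ y, (((singularAction X).subdivMap A).f n)^[k] x =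
      (SSet.chainComplexMap (smallSimplices X 𝒰).ι A).f n y) :
      ∃ y, (((singularAction X).subdivMap A).f n)^[l + k] x =
        (SSet.chainComplexMap (smallSimplices X 𝒰).ι A).f n y := by
    obtain ⟨y, hy⟩ := h
    refine ⟨(((smallAction X 𝒰).subdivMap A).f n)^[l] y, ?_⟩
    rw [Function.iterate_add_apply, hy]
    symm
    refine Function.Semiconj.iterate_right (fun z => ?_) l y
    rw [← ConcreteCategory.comp_apply, ← ConcreteCategory.comp_apply, ← HomologicalComplex.comp_f,
      comm, HomologicalComplex.comp_f]
  let N : AddSubgroup (((TopCat.toSSet.obj X).chainComplex A).X n) :=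
    { carrier := {x | ∃ (k : ℕ) (y : _), (((singularAction X).subdivMap A).f n)^[k] x =
        (SSet.chainComplexMap (smallSimplices X 𝒰).ι A).f n y}
      zero_mem' := ⟨0, 0, by simp⟩
      add_mem' := by
        rintro x x' ⟨k, h⟩ ⟨k', h'⟩
        obtain ⟨y, hy⟩ := step x k k' h
        obtain ⟨y', hy'⟩ := step x' k' k h'
        rw [add_comm] at hy'
        exact ⟨k' + k, y + y', by rw [iterate_map_add, map_add, hy, hy']⟩
      neg_mem' := by
        rintro x ⟨k, y, h⟩
        exact ⟨k, -y, by rw [iterate_map_neg, map_neg, h]⟩ }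
  suffices h : N = ⊤ from (h ▸ AddSubgroup.mem_top x : x ∈ N)
  refine addSubgroup_eq_top N fun σ c => ?_
  obtain ⟨k, hk⟩ := exists_isSmall X 𝒰 hU hX σ
  suffices h : ∀ y ∈ AffineChain.supportedIn (m := n + 1) (n := n)
      fun v => (singularAction X).act σ v ∈ (smallSimplices X 𝒰).obj (op ⦋n⦌),
      (singularAction X).restrict A σ y c ∈
        ((SSet.chainComplexMap (smallSimplices X 𝒰).ι A).f n).hom.range by
    obtain ⟨y, hy⟩ := h _ hk
    exact ⟨k, y, by rw [restrict_subdiv_iterate]; exact hy.symm⟩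
  intro y hy
  rw [AffineChain.supportedIn, Finsupp.supported_eq_span_single] at hy
  induction hy using Submodule.span_induction with
  | mem y hy =>
    obtain ⟨v, hv, rfl⟩ := hy
    refine ⟨(smallSimplices X 𝒰 : SSet.{w}).ιChainComplex (R := A) ⟨_, hv⟩ c, ?_⟩
    rw [AffineAction.restrict_of]
    exact ConcreteCategory.congr_hom (SSet.ι_chainComplexMap_f (R := A)
      (f := (smallSimplices X 𝒰).ι) (x := ⟨_, hv⟩)) c
  | zero => rw [map_zero]; exact zero_mem _
  | add y y' _ _ h h' => rw [map_add]; exact add_mem h h'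
  | smul r y _ h => rw [map_smul]; exact zsmul_mem h r

/-! ### Homology of coproducts and extensions of complexes -/

section Coproduct

variable {ι : Type*} {c : ComplexShape ι} {J : Type u}
  (K : J → HomologicalComplex AddCommGrpCat.{u} c)

/-- A family of complexes in degree `n`, as a short complex of families of abelian groups. -/
def familyShortComplex (n : ι) : ShortComplex (Discrete J ⥤ AddCommGrpCat.{u}) where
  X₁ := Discrete.functor fun i => ((K i).sc n).X₁
  X₂ := Discrete.functor fun i => ((K i).sc n).X₂
  X₃ := Discrete.functor fun i => ((K i).sc n).X₃
  f := Discrete.natTrans fun i => ((K i.as).sc n).f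
  g := Discrete.natTrans fun i => ((K i.as).sc n).g
  zero := by
    ext i : 2
    exact ((K i.as).sc n).zero

/-- Homology of complexes of abelian groups commutes with coproducts, because coproducts of abelian
groups are exact. The complex `L` is a degreewise coproduct of the complexes `K i`. -/
def homologyIsoSigma (L : HomologicalComplex AddCommGrpCat.{u} c) (φ : ∀ i, K i ⟶ L)
    (h : ∀ n, IsColimit (Cofan.mk (L.X n) fun i => (φ i).f n)) (n : ι) :
    L.homology n ≅ ∐ fun i => (K i).homology n := by
  let S := familyShortComplex K n
  let e₀ : S.homology ≅ Discrete.functor fun i => (K i).homology n :=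
    Discrete.natIso fun i =>
      (S.mapHomologyIso ((evaluation (Discrete J) AddCommGrpCat.{u}).obj i)).symm
  let e (k : ι) : colim.obj (Discrete.functor fun i => (K i).X k) ≅ L.X k :=
    (colimit.isColimit _).coconePointUniqueUpToIso (h k)
  have he (k : ι) (i : J) : colimit.ι (Discrete.functor fun i => (K i).X k) ⟨i⟩ ≫ (e k).hom =
      (φ i).f k := IsColimit.comp_coconePointUniqueUpToIso_hom _ (h k) ⟨i⟩
  let e₁ : S.map colim ≅ L.sc n := ShortComplex.isoMk (e _) (e _) (e _)
    (by
      refine colimit.hom_ext fun i => ?_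
      have := colimit.ι_map (F := S.X₁) S.f i
      dsimp at this ⊢
      erw [reassoc_of% (he (c.prev n) i.as), reassoc_of% this, he n i.as]
      exact (φ i.as).comm _ _)
    (by
      refine colimit.hom_ext fun i => ?_
      have := colimit.ι_map (F := S.X₂) S.g i
      dsimp at this ⊢
      erw [reassoc_of% (he n i.as), reassoc_of% this, he _ i.as]
      exact (φ i.as).comm _ _)
  exact (ShortComplex.homologyMapIso e₁).symm ≪≫ S.mapHomologyIso colim ≪≫ colim.mapIso e₀

end Coproduct

section Extend

variable {ι ι' : Type*} {c : ComplexShape ι} {c' : ComplexShape ι'} (e : c.Embedding c')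
  {C : Type*} [Category* C] [Abelian C]

lemma shortExact_extend {S : ShortComplex (HomologicalComplex C c)} (hS : S.ShortExact) :
    (S.map (e.extendFunctor C)).ShortExact := by
  refine HomologicalComplex.shortExact_of_degreewise_shortExact _ fun i' => ?_
  by_cases h : ∃ i, e.f i = i'
  · obtain ⟨i, hi⟩ := h
    refine ShortComplex.shortExact_of_iso (ShortComplex.isoMk
      (S₁ := S.map (HomologicalComplex.eval C c i)) (S.X₁.extendXIso e hi).symm
      (S.X₂.extendXIso e hi).symm (S.X₃.extendXIso e hi).symm ?_ ?_)
      (hS.map_of_exact (HomologicalComplex.eval C c i))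
    · exact ((Iso.eq_inv_comp _).2 (by
        simp only [ShortComplex.map_f, HomologicalComplex.eval_map, Iso.symm_hom]
        exact (HomologicalComplex.extendMap_f S.f e hi).symm)).symm
    · exact ((Iso.eq_inv_comp _).2 (by
        simp only [ShortComplex.map_g, HomologicalComplex.eval_map, Iso.symm_hom]
        exact (HomologicalComplex.extendMap_f S.g e hi).symm)).symm
  · push Not at h
    have h1 := S.X₁.isZero_extend_X e i' h
    have h2 := S.X₂.isZero_extend_X e i' h
    have h3 := S.X₃.isZero_extend_X e i' h
    exact { exact := ShortComplex.exact_of_isZero_X₂ _ h2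
            mono_f := ⟨fun _ _ _ => h1.eq_of_tgt _ _⟩
            epi_g := ⟨fun _ _ _ => h3.eq_of_src _ _⟩ }

end Extend

/-! ### Relative chains -/

/-- Homology of nonnegatively graded chain complexes in all integer degrees. The complex is extended
by zero to a cochain complex, with `K.X n` in cohomological degree `-n`. -/
abbrev extHomology (n : ℤ) : ChainComplex AddCommGrpCat.{u} ℕ ⥤ AddCommGrpCat.{u} :=
  ComplexShape.embeddingDownNat.extendFunctor _ ⋙ HomologicalComplex.homologyFunctor _ _ (-n)

/-- In nonnegative degrees, `extHomology` is homology. -/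
def extHomologyIso (n : ℕ) :
    extHomology.{u} n ≅ HomologicalComplex.homologyFunctor _ _ n :=
  NatIso.ofComponents (fun K => K.extendHomologyIso ComplexShape.embeddingDownNat rfl)
    (fun f => HomologicalComplex.extendHomologyIso_hom_naturality f _ rfl)

lemma isZero_extHomology {n : ℤ} (hn : n < 0) (K : ChainComplex AddCommGrpCat.{u} ℕ) :
    IsZero ((extHomology n).obj K) :=
  (K.extend_exactAt ComplexShape.embeddingDownNat (-n)
    (fun j => by simp only [ComplexShape.embeddingDownNat_f]; lia)).isZero_homology

instance (n : ℤ) {K L : ChainComplex AddCommGrpCat.{u} ℕ} (f : K ⟶ L) [QuasiIso f] :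
    IsIso ((extHomology n).map f) := by
  have : QuasiIso (HomologicalComplex.extendMap f ComplexShape.embeddingDownNat) := inferInstance
  exact inferInstanceAs (IsIso (HomologicalComplex.homologyMap
    (HomologicalComplex.extendMap f ComplexShape.embeddingDownNat) (-n)))

/-- Homology in integer degrees commutes with coproducts. -/
lemma nonempty_extHomologyIsoSigma {J : Type u} (K : J → ChainComplex AddCommGrpCat.{u} ℕ)
    (L : ChainComplex AddCommGrpCat.{u} ℕ) (φ : ∀ i, K i ⟶ L)
    (h : ∀ n, IsColimit (Cofan.mk (L.X n) fun i => (φ i).f n)) (n : ℤ) :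
    Nonempty ((extHomology n).obj L ≅ ∐ fun i => (extHomology n).obj (K i)) := by
  obtain n | n := n
  · exact ⟨(extHomologyIso n).app L ≪≫ homologyIsoSigma K L φ h n ≪≫
      Sigma.mapIso fun i => ((extHomologyIso n).app (K i)).symm⟩
  · have hn : Int.negSucc n < 0 := Int.negSucc_lt_zero n
    refine ⟨(isZero_extHomology hn L).iso ?_⟩
    rw [IsZero.iff_id_eq_zero]
    exact Sigma.hom_ext _ _ fun i => (isZero_extHomology hn (K i)).eq_of_src _ _

/-- The cokernel of a monomorphism of complexes, as a short exact sequence. -/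
lemma shortExact_cokernel {C : Type*} [Category* C] [Abelian C] {K L : C} (f : K ⟶ L) [Mono f] :
    (ShortComplex.mk f (cokernel.π f) (cokernel.condition f)).ShortExact where
  exact := ShortComplex.exact_of_g_is_cokernel _ (cokernelIsCokernel f)

/-- The five lemma for the long exact homology sequences of two monomorphisms. -/
lemma quasiIso_cokernelMap {ι : Type*} {c : ComplexShape ι}
    {K L K' L' : HomologicalComplex AddCommGrpCat.{u} c} (f : K ⟶ L) (f' : K' ⟶ L')
    [Mono f] [Mono f'] (a : K ⟶ K') (b : L ⟶ L') [QuasiIso a] [QuasiIso b]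
    (h : f ≫ b = a ≫ f') : QuasiIso (cokernel.map f f' a b h) :=
  HomologicalComplex.HomologySequence.quasiIso_τ₃
    (S₁ := ShortComplex.mk f (cokernel.π f) (cokernel.condition f))
    (S₂ := ShortComplex.mk f' (cokernel.π f') (cokernel.condition f'))
    { τ₁ := a
      τ₂ := b
      τ₃ := cokernel.map f f' a b h
      comm₁₂ := h.symm
      comm₂₃ := by simp } (shortExact_cokernel f) (shortExact_cokernel f') ‹_› ‹_›

/-- The isomorphism between the homology of the mapping cone of a monomorphism and that of its
cokernel. -/
def coneHomologyIso {K L : ChainComplex AddCommGrpCat.{u} ℕ} (f : K ⟶ L) [Mono f] (n : ℤ) :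
    (CochainComplex.mappingCone (HomologicalComplex.extendMap f
      ComplexShape.embeddingDownNat)).homology (-n) ≅ (extHomology n).obj (cokernel f) :=
  have := CochainComplex.mappingCone.quasiIso_descShortComplex
    (shortExact_extend ComplexShape.embeddingDownNat (shortExact_cokernel f))
  have := (quasiIsoAt_iff_isIso_homologyMap (CochainComplex.mappingCone.descShortComplex
    ((ShortComplex.mk f (cokernel.π f) (cokernel.condition f)).map
      (ComplexShape.embeddingDownNat.extendFunctor AddCommGrpCat.{u}))) (-n)).1 inferInstance
  @asIso _ _ _ _ _ this

/-- The homology of the cokernel of a monomorphism `f` of complexes is the kernel of `f` in homology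
in one degree lower, if `f` is surjective in homology. -/
def relIsoKernel {K L : ChainComplex AddCommGrpCat.{u} ℕ} (f : K ⟶ L) [Mono f] (n : ℤ)
    (h : Epi ((extHomology n).map f)) :
    (extHomology n).obj (cokernel f) ≅ kernel ((extHomology (n - 1)).map f) := by
  let S := (ShortComplex.mk f (cokernel.π f) (cokernel.condition f)).map
    (ComplexShape.embeddingDownNat.extendFunctor AddCommGrpCat.{u})
  have hS : S.ShortExact := shortExact_extend _ (shortExact_cokernel f)
  have hij : (ComplexShape.up ℤ).Rel (-n) (-(n - 1)) := by simp; lia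
  have h3 := hS.homology_exact₃ _ _ hij
  have h1 := hS.homology_exact₁ _ _ hij
  have hg : HomologicalComplex.homologyMap S.g (-n) = 0 := by
    have : Epi (HomologicalComplex.homologyMap S.f (-n)) := h
    rw [← cancel_epi (HomologicalComplex.homologyMap S.f (-n)),
      ← HomologicalComplex.homologyMap_comp, S.zero, HomologicalComplex.homologyMap_zero, comp_zero]
  have : Mono (hS.δ _ _ hij) := h3.mono_g hg
  exact h1.fIsKernel.conePointUniqueUpToIso (limit.isLimit _)

section RelativeSigma

variable {C : Type*} [Category* C] [Preadditive C] [HasCoproducts.{w} C] {A : C}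
  {K U : SSet.{w}} {J : Type*} {V P : J → SSet.{w}} (j : U ⟶ K) (v : ∀ i, V i ⟶ K)
  (p : ∀ i, P i ⟶ V i) (n : ℕ)
  {Q : C} (q : (K.chainComplex A).X n ⟶ Q) (hq₀ : (SSet.chainComplexMap j A).f n ≫ q = 0)
  (hq : IsColimit (CokernelCofork.ofπ q hq₀))
  {R : J → C} (r : ∀ i, ((V i).chainComplex A).X n ⟶ R i)
  (hr₀ : ∀ i, (SSet.chainComplexMap (p i) A).f n ≫ r i = 0)
  (g : ∀ i, R i ⟶ Q) (hg : ∀ i, r i ≫ g i = (SSet.chainComplexMap (v i) A).f n ≫ q)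

include hq hr₀ hg in
/-- If the simplices of `K` which are not in `U` are the disjoint union of the simplices of
`V i` which are not in `P i`, then the relative chains of `(K, U)` are the coproduct of the
relative chains of `(V i, P i)`. -/
lemma nonempty_isColimit_relative [∀ i, Epi (r i)]
    (h₁ : ∀ x : K _⦋n⦌, (∃ u, j.app _ u = x) ∨ ∃ i y, (v i).app _ y = x)
    (h₂ : ∀ i (y : (V i) _⦋n⦌) u, (v i).app _ y = j.app _ u → ∃ z, (p i).app _ z = y)
    (h₃ : ∀ (y y' : Σ i, (V i) _⦋n⦌), (v y.1).app _ y.2 = (v y'.1).app _ y'.2 →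
      (∃ u, j.app _ u = (v y.1).app _ y.2) ∨ y = y') :
    Nonempty (IsColimit (Cofan.mk Q g)) := by
  classical
  have hrz (i : J) (y : (V i) _⦋n⦌) (h : ∃ u, j.app _ u = (v i).app _ y) :
      (V i).ιChainComplex y ≫ r i = 0 := by
    obtain ⟨u, hu⟩ := h
    obtain ⟨z, rfl⟩ := h₂ i y u hu.symm
    rw [← SSet.ι_chainComplexMap_f_assoc, hr₀, comp_zero]
  have hqz (u : U _⦋n⦌) : K.ιChainComplex (j.app _ u) ≫ q = 0 := by
    rw [← SSet.ι_chainComplexMap_f_assoc, hq₀, comp_zero]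
  have hgy (i : J) (y : (V i) _⦋n⦌) : (V i).ιChainComplex y ≫ r i ≫ g i =
      K.ιChainComplex ((v i).app _ y) ≫ q := by
    rw [hg, SSet.ι_chainComplexMap_f_assoc]
  have : Epi q := ⟨fun a b h => Cofork.IsColimit.hom_ext hq h⟩
  -- on a simplex outside `U`, use the piece `V i` which contains it; kill the simplices of `U`
  let d (s : Cofan R) : (K.chainComplex A).X n ⟶ s.pt := chainDesc K fun x =>
    if h : ∃ y : Σ i, (V i) _⦋n⦌, (v y.1).app _ y.2 = x ∧ ¬ ∃ u, j.app _ u = x then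
      (V _).ιChainComplex h.choose.2 ≫ r _ ≫ s.inj h.choose.1 else 0
  have hd (s : Cofan R) : (SSet.chainComplexMap j A).f n ≫ d s = 0 := by
    refine SSet.chainComplex_hom_ext fun u => ?_
    rw [SSet.ι_chainComplexMap_f_assoc, ι_chainDesc, comp_zero, dif_neg]
    rintro ⟨y, -, h⟩
    exact h ⟨u, rfl⟩
  have hdv (s : Cofan R) (i : J) (y : (V i) _⦋n⦌) : K.ιChainComplex ((v i).app _ y) ≫ d s =
      (V i).ιChainComplex y ≫ r i ≫ s.inj i := by
    rw [ι_chainDesc]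
    by_cases hu : ∃ u, j.app _ u = (v i).app _ y
    · rw [dif_neg (by rintro ⟨_, _, h⟩; exact h hu), ← Category.assoc, hrz i y hu, zero_comp]
    · have h : ∃ y' : Σ i, (V i) _⦋n⦌, (v y'.1).app _ y'.2 = (v i).app _ y ∧
          ¬ ∃ u, j.app _ u = (v i).app _ y := ⟨⟨i, y⟩, rfl, hu⟩
      rw [dif_pos h]
      have e := (h₃ ⟨i, y⟩ _ h.choose_spec.1.symm).resolve_left hu
      rw [← e]
  let D (s : Cofan R) : Q ⟶ s.pt :=
    Cofork.IsColimit.desc hq (d s) ((hd s).trans zero_comp.symm)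
  have hD (s : Cofan R) : q ≫ D s = d s :=
    Cofork.IsColimit.π_desc' hq (d s) ((hd s).trans zero_comp.symm)
  refine ⟨Cofan.IsColimit.mk _ D (fun s i => ?_) (fun s m hm => ?_)⟩
  · change g i ≫ D s = _
    rw [← cancel_epi (r i)]
    refine SSet.chainComplex_hom_ext fun y => ?_
    rw [← hdv, ← hD, ← Category.assoc (r i), ← Category.assoc, hgy, Category.assoc]
  · change Q ⟶ s.pt at m
    rw [← cancel_epi q, hD]
    refine SSet.chainComplex_hom_ext fun x => ?_
    obtain ⟨u, rfl⟩ | ⟨i, y, rfl⟩ := h₁ x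
    · rw [← Category.assoc, hqz, zero_comp, ← SSet.ι_chainComplexMap_f_assoc, hd, comp_zero]
    · rw [hdv, ← hm i]
      change _ = _ ≫ r i ≫ g i ≫ m
      rw [← Category.assoc, ← Category.assoc (r i), ← Category.assoc _ (r i ≫ g i), hgy]

end RelativeSigma

/-! ### Singular homology: excision and homotopy invariance -/

/-- The singular chain complex with coefficients in `A`. -/
abbrev singularChains (A : AddCommGrpCat.{u}) [HasCoproducts.{w} AddCommGrpCat.{u}] :
    TopCat.{w} ⥤ ChainComplex AddCommGrpCat.{u} ℕ :=
  (singularChainComplexFunctor AddCommGrpCat.{u}).obj A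

/-- Singular homology in integer degrees is the homology of the extended singular chain
complex. -/
def homologyIntIso (A : AddCommGrpCat.{u}) [HasCoproducts.{w} AddCommGrpCat.{u}] (m : ℤ) :
    homologyInt.{w} A m ≅ singularChains A ⋙ extHomology m :=
  match m with
  | .ofNat n => Functor.isoWhiskerLeft (singularChains A) (extHomologyIso n).symm
  | .negSucc n => NatIso.ofComponents
      (fun X => (AddCommGrpCat.isZero_of_subsingleton (AddCommGrpCat.of PUnit)).iso
        (isZero_extHomology (Int.negSucc_lt_zero n) ((singularChains A).obj X)))
      (fun _ => (isZero_extHomology (Int.negSucc_lt_zero n) _).eq_of_tgt _ _)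

/-- Homotopy inverse maps induce quasi-isomorphisms of singular chain complexes. -/
lemma quasiIso_of_homotopy (A : AddCommGrpCat.{u}) [HasCoproducts.{w} AddCommGrpCat.{u}]
    {X Y : TopCat.{w}} (f : X ⟶ Y) (g : Y ⟶ X) (h : TopCat.Homotopy (f ≫ g) (𝟙 X))
    (h' : TopCat.Homotopy (g ≫ f) (𝟙 Y)) : QuasiIso ((singularChains A).map f) :=
  let e : HomotopyEquiv ((singularChains A).obj X) ((singularChains A).obj Y) :=
    { hom := (singularChains A).map f
      inv := (singularChains A).map g
      homotopyHomInvId := (Homotopy.ofEq ((singularChains A).map_comp f g).symm).trans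
        ((h.singularChainComplexFunctorObjMap A).trans
          (Homotopy.ofEq ((singularChains A).map_id X)))
      homotopyInvHomId := (Homotopy.ofEq ((singularChains A).map_comp g f).symm).trans
        ((h'.singularChainComplexFunctorObjMap A).trans
          (Homotopy.ofEq ((singularChains A).map_id Y))) }
  HomotopyEquiv.quasiIso_hom e

/-- The inclusion of a subspace. -/
abbrev subspaceInc {X : Type w} [TopologicalSpace X] (s : Set X) : TopCat.of s ⟶ TopCat.of X :=
  TopCat.ofHom ⟨Subtype.val, continuous_subtype_val⟩

/-- The inclusion of a subspace in a larger one. -/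
abbrev subspaceMap {X : Type w} [TopologicalSpace X] {s t : Set X} (h : s ⊆ t) :
    TopCat.of s ⟶ TopCat.of t :=
  TopCat.ofHom ⟨Set.inclusion h, continuous_inclusion h⟩

lemma toSSet_map_injective {X Y : TopCat.{w}} (f : X ⟶ Y) (hf : Function.Injective f)
    (n : SimplexCategoryᵒᵖ) : Function.Injective ((TopCat.toSSet.map f).app n) := by
  intro σ τ h
  apply (X.toSSetObjEquiv n).injective
  ext t
  apply hf
  exact DFunLike.congr_fun (congrArg (Y.toSSetObjEquiv n) h) t

lemma mono_singularChains_map (A : AddCommGrpCat.{u}) [HasCoproducts.{w} AddCommGrpCat.{u}]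
    {X Y : TopCat.{w}} (f : X ⟶ Y) (hf : Function.Injective f) :
    Mono ((singularChains A).map f) :=
  have (n : ℕ) : Mono (((singularChains A).map f).f n) :=
    mono_chainComplexMap_f (TopCat.toSSet.map f) A n (toSSet_map_injective f hf _)
  HomologicalComplex.mono_of_mono_f _ this

instance mono_subspaceInc (A : AddCommGrpCat.{u}) [HasCoproducts.{w} AddCommGrpCat.{u}]
    {X : Type w} [TopologicalSpace X] (s : Set X) : Mono ((singularChains A).map (subspaceInc s)) :=
  mono_singularChains_map A _ Subtype.val_injective

instance mono_subspaceMap (A : AddCommGrpCat.{u}) [HasCoproducts.{w} AddCommGrpCat.{u}]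
    {X : Type w} [TopologicalSpace X] {s t : Set X} (h : s ⊆ t) :
    Mono ((singularChains A).map (subspaceMap h)) :=
  mono_singularChains_map A _ (Set.inclusion_injective h)

lemma exists_toSSet_lift {X : Type w} [TopologicalSpace X] (s : Set X) {n : SimplexCategoryᵒᵖ}
    (σ : (TopCat.toSSet.obj (TopCat.of X)).obj n)
    (h : Set.range ((TopCat.of X).toSSetObjEquiv n σ) ⊆ s) :
    ∃ τ, (TopCat.toSSet.map (subspaceInc s)).app n τ = σ := by
  refine ⟨((TopCat.of s).toSSetObjEquiv n).symm
    ⟨fun t => ⟨(TopCat.of X).toSSetObjEquiv n σ t, h ⟨t, rfl⟩⟩, by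
      exact ((TopCat.of X).toSSetObjEquiv n σ).continuous.subtype_mk _⟩, ?_⟩
  apply ((TopCat.of X).toSSetObjEquiv n).injective
  rfl

lemma range_toSSet_map {X : Type w} [TopologicalSpace X] (s : Set X) {n : SimplexCategoryᵒᵖ}
    (τ : (TopCat.toSSet.obj (TopCat.of s)).obj n) :
    Set.range ((TopCat.of X).toSSetObjEquiv n ((TopCat.toSSet.map (subspaceInc s)).app n τ)) ⊆
      s := by
  rintro _ ⟨t, rfl⟩
  exact ((TopCat.of s).toSSetObjEquiv n τ t).2

/-- Degreewise, the projection to the cokernel of a chain map is a cokernel. -/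
def isColimitCokernelEval {K L : ChainComplex AddCommGrpCat.{u} ℕ} (f : K ⟶ L) [Mono f] (n : ℕ) :
    IsColimit (CokernelCofork.ofπ (f := f.f n) ((cokernel.π f).f n) (by
      rw [← HomologicalComplex.comp_f, cokernel.condition, HomologicalComplex.zero_f])) :=
  ((shortExact_cokernel f).map_of_exact (HomologicalComplex.eval _ _ n)).gIsCokernel

/-- Excision: if a space is covered by open sets `U` and `V i`, where the intersection of any
two of the `V i` lies in `U`, then its homology relative to `U` is the direct sum of the homology
groups of the `V i` relative to `V i ∩ U`. -/
theorem nonempty_excisionIso (A : AddCommGrpCat.{u}) {X : Type u} [TopologicalSpace X]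
    (U : Set X) (hU : IsOpen U) {J : Type u} (V : J → Set X) (hV : ∀ i, IsOpen (V i))
    (hcover : U ∪ ⋃ i, V i = Set.univ) (hdisj : Pairwise fun i j => V i ∩ V j ⊆ U) (n : ℤ) :
    Nonempty ((extHomology n).obj (cokernel ((singularChains A).map (subspaceInc U))) ≅
      ∐ fun i => (extHomology n).obj (cokernel ((singularChains A).map
        (subspaceMap (Set.inter_subset_left : V i ∩ U ⊆ V i))))) := by
  -- the open cover by `U` (the index `none`) and the `V i`
  let 𝒰 : Option J → Set (TopCat.of X) := fun o => o.elim U V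
  let K : SSet.{u} := smallSimplices (TopCat.of X) 𝒰
  let k : K ⟶ TopCat.toSSet.obj (TopCat.of X) := (smallSimplices (TopCat.of X) 𝒰).ι
  have hk (m) : Function.Injective (k.app m) := Subtype.val_injective
  have : QuasiIso (SSet.chainComplexMap k A) := by
    refine quasiIso_smallSimplices _ 𝒰 (fun o => ?_) ?_ A
    · cases o
      exacts [hU, hV _]
    · rw [Set.iUnion_option]
      exact hcover
  let inc (o : Option J) : TopCat.toSSet.obj (TopCat.of (𝒰 o)) ⟶ K :=
    SSet.Subcomplex.lift (TopCat.toSSet.map (subspaceInc (𝒰 o))) (by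
      rintro m _ ⟨τ, rfl⟩
      exact ⟨o, range_toSSet_map _ τ⟩)
  have hinc (o : Option J) : inc o ≫ k = TopCat.toSSet.map (subspaceInc (𝒰 o)) := rfl
  have hinc' (o : Option J) (m) (τ) : k.app m ((inc o).app m τ) =
      (TopCat.toSSet.map (subspaceInc (𝒰 o))).app m τ := rfl
  let j : TopCat.toSSet.obj (TopCat.of U) ⟶ K := inc none
  let v (i : J) : TopCat.toSSet.obj (TopCat.of (V i)) ⟶ K := inc (some i)
  let p (i : J) : TopCat.toSSet.obj (TopCat.of ↑(V i ∩ U)) ⟶ TopCat.toSSet.obj (TopCat.of (V i)) :=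
    TopCat.toSSet.map (subspaceMap Set.inter_subset_left)
  let q (i : J) : TopCat.toSSet.obj (TopCat.of ↑(V i ∩ U)) ⟶ TopCat.toSSet.obj (TopCat.of U) :=
    TopCat.toSSet.map (subspaceMap Set.inter_subset_right)
  have hpq (i : J) : p i ≫ v i = q i ≫ j := rfl
  have : Mono (SSet.chainComplexMap j A) := by
    have : Mono (SSet.chainComplexMap j A ≫ SSet.chainComplexMap k A) := by
      rw [← Functor.map_comp]
      exact mono_subspaceInc A U
    exact mono_of_mono _ (SSet.chainComplexMap k A)
  let C₀ := (TopCat.toSSet.obj (TopCat.of U)).chainComplex A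
  let f₀ : C₀ ⟶ (TopCat.toSSet.obj (TopCat.of X)).chainComplex A :=
    SSet.chainComplexMap (TopCat.toSSet.map (subspaceInc U)) A
  have : Mono f₀ := mono_subspaceInc A U
  have hf₀ : SSet.chainComplexMap j A ≫ SSet.chainComplexMap k A = 𝟙 C₀ ≫ f₀ :=
    (((SSet.chainComplexFunctor AddCommGrpCat.{u}).obj A).map_comp j k).symm.trans
      (Category.id_comp f₀).symm
  have hp (i : J) : Mono (SSet.chainComplexMap (p i) A) := mono_subspaceMap A _
  -- compare the chains of `X` with the small chains
  have : QuasiIso (cokernel.map (SSet.chainComplexMap j A) f₀ (𝟙 _) (SSet.chainComplexMap k A)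
      hf₀) :=
    quasiIso_cokernelMap _ _ _ _ _
  let e₁ := asIso ((extHomology n).map (cokernel.map (SSet.chainComplexMap j A) f₀ (𝟙 _)
    (SSet.chainComplexMap k A) hf₀))
  let g (i : J) : cokernel (SSet.chainComplexMap (p i) A) ⟶ cokernel (SSet.chainComplexMap j A) :=
    cokernel.map _ _ (SSet.chainComplexMap (q i) A) (SSet.chainComplexMap (v i) A) (by
      rw [← Functor.map_comp, ← Functor.map_comp, hpq])
  -- modulo the chains of `U`, the small chains are the direct sum of the chains of the `V i`
  have key (m : ℕ) : Nonempty (IsColimit (Cofan.mk ((cokernel (SSet.chainComplexMap j A)).X m)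
      fun i => (g i).f m)) := by
    have (i : J) : Epi ((cokernel.π (SSet.chainComplexMap (p i) A)).f m) := inferInstance
    refine nonempty_isColimit_relative j v p m _ _
      (isColimitCokernelEval (SSet.chainComplexMap j A) m)
      (fun i => (cokernel.π (SSet.chainComplexMap (p i) A)).f m) (fun i => ?_) _ (fun i => ?_)
      (fun x => ?_) (fun i y z h => ?_) ?_
    · rw [← HomologicalComplex.comp_f, cokernel.condition, HomologicalComplex.zero_f]
    · rw [← HomologicalComplex.comp_f, ← HomologicalComplex.comp_f, cokernel.π_desc]
    · obtain ⟨o, ho⟩ := x.2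
      obtain ⟨τ, hτ⟩ := exists_toSSet_lift _ x.1 ho
      cases o with
      | none => exact .inl ⟨τ, Subtype.ext hτ⟩
      | some i => exact .inr ⟨i, τ, Subtype.ext hτ⟩
    · have h' := congrArg (k.app _) h
      have hy := range_toSSet_map (V i) y
      have hz := range_toSSet_map U z
      obtain ⟨τ, hτ⟩ := exists_toSSet_lift (V i ∩ U) _ (Set.subset_inter hy (by
        have h₁ := hz
        change Set.range ((TopCat.of X).toSSetObjEquiv _ (k.app _ (j.app _ z))) ⊆ _ at h₁
        rwa [← h'] at h₁))
      refine ⟨τ, toSSet_map_injective (subspaceInc (V i)) Subtype.val_injective _ ?_⟩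
      exact hτ
    · rintro ⟨i, y⟩ ⟨i', y'⟩ h
      have h' := congrArg (k.app _) h
      by_cases hi : i = i'
      · subst hi
        right
        exact congrArg (Sigma.mk i)
          (toSSet_map_injective (subspaceInc (V i)) Subtype.val_injective _ h')
      · left
        have hy := range_toSSet_map (V i) y
        have hy' := range_toSSet_map (V i') y'
        obtain ⟨τ, hτ⟩ := exists_toSSet_lift U _ ((Set.subset_inter hy (by
          have h₁ := hy'
          change Set.range ((TopCat.of X).toSSetObjEquiv _ (k.app _ ((v i').app _ y'))) ⊆ _ at h₁
          rwa [← h'] at h₁)).trans (hdisj hi))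
        exact ⟨τ, hk _ hτ⟩
  obtain ⟨e₂⟩ := nonempty_extHomologyIsoSigma _ _ g (fun m => (key m).some) n
  exact ⟨e₁.symm ≪≫ e₂⟩

/-- If `V` has the homology of a point and `P` is nonempty, the homology of `V` relative to `P` is
the reduced homology of `P` in one degree lower. -/
lemma nonempty_relIsoReducedHomology (A : AddCommGrpCat.{u}) {P V : TopCat.{u}} (f : P ⟶ V)
    [Mono ((singularChains A).map f)] (x : P)
    (hV : QuasiIso ((singularChains A).map
      (TopCat.ofHom (ContinuousMap.const V PUnit.unit) : V ⟶ TopCat.of PUnit.{u + 1}))) (n : ℤ) :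
    Nonempty ((extHomology n).obj (cokernel ((singularChains A).map f)) ≅
      reducedHomology A (n - 1) P) := by
  let a : TopCat.of PUnit.{u + 1} ⟶ P := TopCat.ofHom (ContinuousMap.const _ x)
  let b : V ⟶ TopCat.of PUnit.{u + 1} := TopCat.ofHom (ContinuousMap.const V PUnit.unit)
  have hb (m : ℤ) : IsIso ((extHomology m).map ((singularChains A).map b)) := inferInstance
  -- `P` is nonempty, so `P ⟶ V` is surjective in homology: compose it with the map from a point
  have hf (m : ℤ) : Epi ((extHomology m).map ((singularChains A).map f)) := by
    have : a ≫ f ≫ b = 𝟙 _ := rfl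
    have : ((extHomology m).map ((singularChains A).map (a ≫ f ≫ b))) = 𝟙 _ := by
      rw [this, CategoryTheory.Functor.map_id, CategoryTheory.Functor.map_id]
    rw [Functor.map_comp, Functor.map_comp, Functor.map_comp, Functor.map_comp] at this
    have h1 : Epi ((extHomology m).map ((singularChains A).map f) ≫
        (extHomology m).map ((singularChains A).map b)) := epi_of_epi_fac this
    have h2 := epi_comp ((extHomology m).map ((singularChains A).map f) ≫
        (extHomology m).map ((singularChains A).map b))
        (inv ((extHomology m).map ((singularChains A).map b)))
    simpa using h2
  refine ⟨relIsoKernel _ n (hf n) ≪≫ (kernelCompMono _ ((extHomology (n - 1)).map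
    ((singularChains A).map b))).symm ≪≫ kernel.mapIso _ _
    ((homologyIntIso A (n - 1)).app P).symm
    ((homologyIntIso A (n - 1)).app (TopCat.of PUnit.{u + 1})).symm ?_⟩
  rw [← Functor.map_comp, ← Functor.map_comp]
  exact (homologyIntIso A (n - 1)).inv.naturality (f ≫ b)

/-! ### The spectral sequence of a filtered complex -/

instance : homologicalCore.HasFirstPageComputation where
  hi₀₁ _ := rfl
  hi₂₃ pq := by simp only [homologicalCore_i₂, homologicalCore_i₃]; lia

/-- The objects of the spectral object of a diagram of complexes are the cohomology groups of
mapping cones. -/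
def spectralObjectHIso {C : Type*} [Category* C] [Abelian C] (K : ℤ ⥤ CochainComplex C ℤ) (n : ℤ) :
    (spectralObjectOfComplexes K).H n ≅ (K.mapComposableArrows 1 ⋙
      HomotopyCategory.composableArrowsFunctor C) ⋙ HomologicalComplex.homologyFunctor C _ n :=
  Functor.isoWhiskerLeft (K.mapComposableArrows 1 ⋙ HomotopyCategory.composableArrowsFunctor C)
    (HomotopyCategory.homologyFunctorFactors C (ComplexShape.up ℤ) n)

/-- If `K` is zero, the inclusion of `L` in the mapping cone of `K ⟶ L` is an isomorphism. -/
lemma isIso_inr {C : Type*} [Category* C] [Abelian C] {K L : CochainComplex C ℤ}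
    (f : K ⟶ L) (hK : IsZero K) : IsIso (CochainComplex.mappingCone.inr f) := by
  let g : CochainComplex.mappingCone f ⟶ L := CochainComplex.mappingCone.desc f 0 (𝟙 L) (by
    rw [hK.eq_of_src (f ≫ 𝟙 L) 0]; simp)
  refine ⟨g, CochainComplex.mappingCone.inr_desc _ _ _ _, ?_⟩
  ext n
  have hz : IsZero (K.X (n + 1)) := (HomologicalComplex.eval C _ (n + 1)).map_isZero hK
  refine CochainComplex.mappingCone.ext_from f (n + 1) n rfl (hz.eq_of_src _ _) ?_
  simp [g]

section

variable {C : Type*} [Category* C] [Abelian C] (K : ℤ ⥤ CochainComplex C ℤ)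

/-- If `K i` is zero, then `H^n(i ⟶ j)` is the cohomology of `K j`. -/
def spectralObjectHObjIso (n : ℤ) {i j : ℤ} (f : i ⟶ j) (hK : IsZero (K.obj i)) :
    (K.obj j).homology n ≅ ((spectralObjectOfComplexes K).H n).obj (ComposableArrows.mk₁ f) :=
  have := isIso_inr (K.map f) hK
  (HomologicalComplex.homologyFunctor C _ n).mapIso
    (asIso (CochainComplex.mappingCone.inr (K.map f))) ≪≫
      ((spectralObjectHIso K n).app (ComposableArrows.mk₁ f)).symm

lemma spectralObjectHObjIso_naturality (n : ℤ) {i j k : ℤ} (f : i ⟶ j) (g : j ⟶ k)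
    (fg : i ⟶ k) (h : f ≫ g = fg) (hK : IsZero (K.obj i)) :
    (spectralObjectHObjIso K n f hK).hom ≫
      ((spectralObjectOfComplexes K).H n).map (ComposableArrows.twoδ₂Toδ₁ f g fg h) =
    HomologicalComplex.homologyMap (K.map g) n ≫ (spectralObjectHObjIso K n fg hK).hom := by
  have e := (spectralObjectHIso K n).inv.naturality (ComposableArrows.twoδ₂Toδ₁ f g fg h)
  refine (Category.assoc _ _ _).trans ((congrArg _ e.symm).trans ((Category.assoc _ _ _).symm.trans
    (Eq.trans (congrArg (· ≫ _) ?_) (Category.assoc _ _ _))))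
  let φ : CochainComplex.mappingCone (K.map f) ⟶ CochainComplex.mappingCone (K.map fg) :=
    CochainComplex.mappingCone.map _ _ (K.map (𝟙 i)) (K.map g) (by
      rw [← K.map_comp, ← K.map_comp, Category.id_comp, h])
  have hφ : CochainComplex.mappingCone.inr (K.map f) ≫ φ =
      K.map g ≫ CochainComplex.mappingCone.inr (K.map fg) :=
    CochainComplex.mappingCone.inr_desc _ _ _ _
  exact (HomologicalComplex.homologyMap_comp _ φ n).symm.trans
    ((congrArg (HomologicalComplex.homologyMap · n) hφ).trans
      (HomologicalComplex.homologyMap_comp _ _ n))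

end

/-- The term `E(f₁, f₂, f₃)` is the quotient of `H^n(i₀ ⟶ i₂)` by the classes which, in
`H^n(i₀ ⟶ i₃)`, come from `H^n(i₀ ⟶ i₁)`. -/
lemma exists_surjective_E (X : Abelian.SpectralObject AddCommGrpCat.{u} ℤ) {i₀ i₁ i₂ i₃ : ℤ}
    (f₁ : i₀ ⟶ i₁) (f₂ : i₁ ⟶ i₂) (f₃ : i₂ ⟶ i₃) (f₁₂ : i₀ ⟶ i₂) (f₁₃ : i₀ ⟶ i₃) (n : ℤ)
    (h₁₂ : f₁ ≫ f₂ = f₁₂) (h₁₃ : f₁₂ ≫ f₃ = f₁₃) :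
    ∃ g : (X.H n).obj (ComposableArrows.mk₁ f₁₂) ⟶
        X.E f₁ f₂ f₃ (n - 1) n (n + 1) (by lia) rfl,
      Function.Surjective g ∧ ∀ x, g x = 0 ↔ ∃ y,
        (X.H n).map (ComposableArrows.twoδ₂Toδ₁ f₁₂ f₃ f₁₃ h₁₃) x =
          (X.H n).map (ComposableArrows.twoδ₂Toδ₁ f₁₂ f₃ f₁₃ h₁₃)
            ((X.H n).map (ComposableArrows.twoδ₂Toδ₁ f₁ f₂ f₁₂ h₁₂) y) := by
  let S := X.cokernelSequenceE f₁ f₂ f₃ f₁₂ h₁₂ (n - 1) n (n + 1)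
  have hS : S.Exact := X.cokernelSequenceE_exact ..
  let α := (X.H n).map (ComposableArrows.twoδ₂Toδ₁ f₁ f₂ f₁₂ h₁₂)
  let β := (X.H n).map (ComposableArrows.twoδ₂Toδ₁ f₁₂ f₃ f₁₃ h₁₃)
  let d := X.δ f₁₂ f₃ (n - 1) n
  let g : (X.H n).obj (ComposableArrows.mk₁ f₁₂) ⟶ X.E f₁ f₂ f₃ (n - 1) n (n + 1) := S.g
  have hg : Epi g := inferInstanceAs (Epi (X.cokernelSequenceE f₁ f₂ f₃ f₁₂ h₁₂ _ _ _ _ _).g)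
  have hz : biprod.desc α d ≫ g = 0 := S.zero
  have hαg (a) : g (α a) = 0 := by
    have : α ≫ g = 0 := by rw [← biprod.inl_desc α d, Category.assoc, hz, comp_zero]
    exact ConcreteCategory.congr_hom this a
  have hdg (a) : g (d a) = 0 := by
    have : d ≫ g = 0 := by rw [← biprod.inr_desc α d, Category.assoc, hz, comp_zero]
    exact ConcreteCategory.congr_hom this a
  have hβd (a) : β (d a) = 0 := ConcreteCategory.congr_hom
    (X.zero₁ f₁₂ f₃ f₁₃ h₁₃ (n - 1) n) a
  have hex (x) (h : g x = 0) : ∃ w, biprod.desc α d w = x :=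
    (ShortComplex.ab_exact_iff _).1 hS x h
  have hex' (x) (h : β x = 0) : ∃ w, d w = x :=
    (ShortComplex.ab_exact_iff _).1 (X.exact₁ f₁₂ f₃ f₁₃ h₁₃ (n - 1) n) x h
  refine ⟨g, (AddCommGrpCat.epi_iff_surjective _).1 hg, fun x => ⟨fun h => ?_, ?_⟩⟩
  · obtain ⟨w, rfl⟩ := hex x h
    let w₁ := (biprod.fst (X := (X.H n).obj (ComposableArrows.mk₁ f₁))
      (Y := (X.H (n - 1)).obj (ComposableArrows.mk₁ f₃))) w
    let w₂ := (biprod.snd (X := (X.H n).obj (ComposableArrows.mk₁ f₁))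
      (Y := (X.H (n - 1)).obj (ComposableArrows.mk₁ f₃))) w
    refine ⟨w₁, ?_⟩
    have hw : biprod.desc α d w = α w₁ + d w₂ := by
      rw [biprod.desc_eq]
      rfl
    rw [hw, map_add]
    change _ + β (d _) = _
    rw [hβd, add_zero]
  · rintro ⟨y, h⟩
    obtain ⟨b, hb⟩ := hex' (x - α y) (by rw [map_sub]; exact sub_eq_zero.2 h)
    rw [← sub_add_cancel x (α y), ← hb, map_add, hαg, hdg, add_zero]

/-- If the filtration is zero in degree `p - r`, the term `E^r_{p,q}` is the quotient of the
homology of the `p`-th step by the classes which, in the homology of the step `p + r - 1`, come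
from the step `p - 1`. -/
lemma exists_epi_page (K : ℤ ⥤ CochainComplex AddCommGrpCat.{u} ℤ) (r : ℤ) (hr : 1 ≤ r) (p q : ℤ)
    (hK : IsZero (K.obj (p - r))) :
    ∃ π : (K.obj p).homology (-(p + q)) ⟶
        (((spectralObjectOfComplexes K).spectralSequence homologicalCore).page r hr).X (p, q),
      Function.Surjective π ∧ ∀ x, π x = 0 ↔ ∃ y,
        HomologicalComplex.homologyMap (K.map (homOfLE (by lia : p ≤ p + r - 1))) _ x =
          HomologicalComplex.homologyMap (K.map (homOfLE (by lia : p - 1 ≤ p + r - 1))) _ y := by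
  let X := spectralObjectOfComplexes K
  let n : ℤ := -(p + q)
  let f₁ : p - r ⟶ p - 1 := homOfLE (by lia)
  let f₂ : p - 1 ⟶ p := homOfLE (by lia)
  let f₃ : p ⟶ p + r - 1 := homOfLE (by lia)
  let f₁₂ : p - r ⟶ p := homOfLE (by lia)
  let f₁₃ : p - r ⟶ p + r - 1 := homOfLE (by lia)
  obtain ⟨g, hg, hg'⟩ := exists_surjective_E X f₁ f₂ f₃ f₁₂ f₁₃ n rfl rfl
  let e := X.spectralSequencePageXIso homologicalCore r hr (p, q) (p - r) (p - 1) p (p + r - 1)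
    rfl rfl rfl rfl (n - 1) n (n + 1) rfl
  have surj {A B : AddCommGrpCat.{u}} (φ : A ≅ B) : Function.Surjective φ.hom :=
    (AddCommGrpCat.epi_iff_surjective φ.hom).1 inferInstance
  have inj {A B : AddCommGrpCat.{u}} (φ : A ≅ B) : Function.Injective φ.hom :=
    (AddCommGrpCat.mono_iff_injective φ.hom).1 inferInstance
  let k : (K.obj p).homology n ≅ (X.H n).obj (ComposableArrows.mk₁ f₁₂) :=
    spectralObjectHObjIso K n f₁₂ hK
  let k₁ : (K.obj (p - 1)).homology n ≅ (X.H n).obj (ComposableArrows.mk₁ f₁) :=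
    spectralObjectHObjIso K n f₁ hK
  let k₃ : (K.obj (p + r - 1)).homology n ≅ (X.H n).obj (ComposableArrows.mk₁ f₁₃) :=
    spectralObjectHObjIso K n f₁₃ hK
  refine ⟨k.hom ≫ g ≫ e.inv, ((surj e.symm).comp hg).comp (surj k), fun x => ?_⟩
  have h1 : (k.hom ≫ g ≫ e.inv) x = 0 ↔ g (k.hom x) = 0 := map_eq_zero_iff e.inv.hom (inj e.symm)
  have n1 (y) : (X.H n).map (ComposableArrows.twoδ₂Toδ₁ f₁ f₂ f₁₂ rfl) (k₁.hom y) =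
      k.hom (HomologicalComplex.homologyMap (K.map f₂) n y) :=
    ConcreteCategory.congr_hom (spectralObjectHObjIso_naturality K n f₁ f₂ f₁₂ rfl hK) y
  have n2 (y) : (X.H n).map (ComposableArrows.twoδ₂Toδ₁ f₁₂ f₃ f₁₃ rfl) (k.hom y) =
      k₃.hom (HomologicalComplex.homologyMap (K.map f₃) n y) :=
    ConcreteCategory.congr_hom (spectralObjectHObjIso_naturality K n f₁₂ f₃ f₁₃ rfl hK) y
  have n3 (y) : HomologicalComplex.homologyMap (K.map (homOfLE (by lia : p - 1 ≤ p + r - 1))) n y =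
      HomologicalComplex.homologyMap (K.map f₃) n
        (HomologicalComplex.homologyMap (K.map f₂) n y) := by
    rw [show homOfLE (by lia : p - 1 ≤ p + r - 1) = f₂ ≫ f₃ from rfl, K.map_comp,
      HomologicalComplex.homologyMap_comp]
    rfl
  rw [h1, hg', (surj k₁).exists]
  refine exists_congr fun y => ?_
  rw [n1, n2, n2, (inj k₃).eq_iff, n3]

/-- A quotient of `B` in which exactly the elements with `f x` in the image of `f'` become zero is
the image of `f`, modulo the image of `f'`. -/
lemma nonempty_isoImageQuotient {E B B' C : AddCommGrpCat.{u}} (π : B ⟶ E)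
    (hπ : Function.Surjective π) (f : B ⟶ C) (f' : B' ⟶ C)
    (h : ∀ x, π x = 0 ↔ ∃ y, f x = f' y) :
    Nonempty (E ≅ AddCommGrpCat.of
      (f.hom.range ⧸ f'.hom.range.addSubgroupOf f.hom.range)) := by
  let g : B →+ f.hom.range ⧸ f'.hom.range.addSubgroupOf f.hom.range :=
    (QuotientAddGroup.mk' _).comp f.hom.rangeRestrict
  have hg : Function.Surjective g :=
    (QuotientAddGroup.mk'_surjective _).comp f.hom.rangeRestrict_surjective
  have hk : π.hom.ker = g.ker := by
    ext x
    rw [AddMonoidHom.mem_ker, AddMonoidHom.mem_ker]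
    refine (h x).trans ?_
    change _ ↔ QuotientAddGroup.mk' _ (f.hom.rangeRestrict x) = 0
    rw [QuotientAddGroup.mk'_apply, QuotientAddGroup.eq_zero_iff, AddSubgroup.mem_addSubgroupOf]
    exact exists_congr fun y => eq_comm
  exact ⟨(((QuotientAddGroup.quotientKerEquivOfSurjective π.hom hπ).symm.trans
    (QuotientAddGroup.quotientAddEquivOfEq hk)).trans
      (QuotientAddGroup.quotientKerEquivOfSurjective g hg)).toAddCommGrpIso⟩

/-! ### The spectral sequence of a filtered space -/

section

variable {X : Type u} [TopologicalSpace X] (A : AddCommGrpCat.{u}) (Y : ℤ → Set X)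
  (hY : Monotone Y)

/-- The cohomology of a mapping cone of chain complexes of subspaces is relative homology. -/
def spectralObjectIsoCokernel (n : ℤ) {a b : ℤ} (h : a ≤ b) :
    ((spectralObjectOfComplexes (filtrationDiagram Y hY ⋙ singularComplex A)).H (-n)).obj
      (ComposableArrows.mk₁ (homOfLE h)) ≅
    (extHomology n).obj (cokernel ((singularChains A).map (subspaceMap (hY h)))) :=
  (spectralObjectHIso _ _).app _ ≪≫ coneHomologyIso ((singularChains A).map (subspaceMap (hY h))) n

/-- The first page consists of the relative homology groups of the successive filtration steps. -/
def firstPageIso (p q : ℤ) :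
    ((filtrationSpectralSequence A Y hY).page 1 le_rfl).X (p, q) ≅
      (extHomology (p + q)).obj (cokernel ((singularChains A).map
        (subspaceMap (hY (sub_one_lt p).le)))) :=
  (spectralObjectOfComplexes _).spectralSequenceFirstPageXIso homologicalCore (p, q) (p - 1) p
    rfl rfl (-(p + q)) rfl ≪≫ spectralObjectIsoCokernel A Y hY (p + q) (sub_one_lt p).le

lemma isZero_page_of_eq (r : ℤ) (hr : 1 ≤ r) (p q : ℤ) (h : Y (p - 1) = Y p) :
    IsZero (((filtrationSpectralSequence A Y hY).page r hr).X (p, q)) := by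
  refine Abelian.SpectralObject.isZero_spectralSequence_page_X_of_isZero_H _ _ r hr (p, q)
    (-(p + q)) rfl (p - 1) p rfl rfl ?_
  refine IsZero.of_iso ?_ (spectralObjectIsoCokernel A Y hY (p + q) (sub_one_lt p).le)
  have : IsIso (subspaceMap (hY (sub_one_lt p).le)) :=
    ⟨subspaceMap h.ge, rfl, rfl⟩
  exact (extHomology (p + q)).map_isZero (isZero_cokernel_of_epi _)

lemma isZero_singularChains_of_isEmpty [HasCoproducts.{w} AddCommGrpCat.{u}] (T : TopCat.{w})
    [IsEmpty T] : IsZero ((singularChains A).obj T) := by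
  rw [IsZero.iff_id_eq_zero]
  ext1 n
  refine SSet.chainComplex_hom_ext (X := TopCat.toSSet.obj T) fun σ => ?_
  exact isEmptyElim ((T.toSSetObjEquiv _ σ) (stdSimplex.vertex 0))

lemma nonempty_firstPageIso_of_isEmpty (p q : ℤ) (h : Y (p - 1) = ∅) :
    Nonempty (((filtrationSpectralSequence A Y hY).page 1 le_rfl).X (p, q) ≅
      (homologyInt A (p + q)).obj (TopCat.of (Y p))) := by
  have : IsEmpty (TopCat.of (Y (p - 1))) := Set.isEmpty_coe_sort.2 h
  let f := (singularChains A).map (subspaceMap (hY (sub_one_lt p).le))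
  have hf : f = 0 := (isZero_singularChains_of_isEmpty A _).eq_of_src _ _
  refine ⟨firstPageIso A Y hY p q ≪≫ ?_⟩
  exact (extHomology (p + q)).mapIso (cokernelIsoOfEq hf ≪≫ cokernelZeroIsoTarget) ≪≫
    ((homologyIntIso A (p + q)).app _).symm

/-- A finite filtration which starts with the empty set and reaches the whole space has a
spectral sequence that degenerates to the graded pieces of the homology of the space. -/
theorem exists_stable_page (N : ℤ) (hN : 0 ≤ N) (h₀ : ∀ p < 0, Y p = ∅)
    (h₁ : ∀ p, N ≤ p → Y p = Set.univ) :
    ∃ (r₀ : ℤ) (hr₀ : 1 ≤ r₀), ∀ (r : ℤ) (hr : r₀ ≤ r),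
      (∀ a b : ℤ × ℤ, ((filtrationSpectralSequence A Y hY).page r (hr₀.trans hr)).d a b = 0) ∧
      ∀ p q : ℤ, Nonempty
        (((filtrationSpectralSequence A Y hY).page r (hr₀.trans hr)).X (p, q) ≅
          gradedPiece A (p + q) (Y p) (Y (p - 1))) := by
  -- for `r ≥ N + 1` and `0 ≤ p ≤ N`, one has `Y (p - r) = ∅` and `Y (p + r - 1) = univ`
  refine ⟨N + 1, by lia, fun r hr => ⟨?_, fun p q => ?_⟩⟩
  · rintro ⟨p, q⟩ ⟨p', q'⟩
    have hr1 : 1 ≤ r := by lia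
    by_cases hp : p < 0
    · exact (isZero_page_of_eq A Y hY r hr1 p q
        ((h₀ _ (by lia)).trans (h₀ _ hp).symm)).eq_of_src _ _
    by_cases hp' : N < p
    · exact (isZero_page_of_eq A Y hY r hr1 p q
        ((h₁ _ (by lia)).trans (h₁ _ (by lia)).symm)).eq_of_src _ _
    by_cases hpp : p' < 0
    · exact (isZero_page_of_eq A Y hY r hr1 p' q'
        ((h₀ _ (by lia)).trans (h₀ _ hpp).symm)).eq_of_tgt _ _
    · apply HomologicalComplex.shape
      intro h
      have := congrArg Prod.fst h
      simp at this
      lia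
  · by_cases hpp : Y (p - 1) = Y p
    · refine ⟨(isZero_page_of_eq A Y hY r (by lia) p q hpp).iso ?_⟩
      rw [gradedPiece, hpp, AddSubgroup.addSubgroupOf_self]
      have := QuotientAddGroup.subsingleton_quotient_top (G := homologyImage A (p + q) (Y p))
      exact AddCommGrpCat.isZero_of_subsingleton _
    -- the images of `H_n(Y p)` in the homology of `Y (p + r - 1)` and of `X` are compared
    have hp : 0 ≤ p := by
      by_contra hp
      exact hpp ((h₀ _ (by lia)).trans (h₀ _ (by lia)).symm)
    have hp' : p ≤ N := by
      by_contra hp'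
      exact hpp ((h₁ _ (by lia)).trans (h₁ _ (by lia)).symm)
    have : IsEmpty (TopCat.of (Y (p - r))) := Set.isEmpty_coe_sort.2 (h₀ _ (by lia))
    have hK : IsZero ((filtrationDiagram Y hY ⋙ singularComplex A).obj (p - r)) :=
      (ComplexShape.embeddingDownNat.extendFunctor AddCommGrpCat.{u}).map_isZero
        (isZero_singularChains_of_isEmpty A (TopCat.of (Y (p - r))))
    obtain ⟨π, hπ, hπ'⟩ := exists_epi_page (filtrationDiagram Y hY ⋙ singularComplex A) r
      (by lia) p q hK
    let F := homologyInt A (p + q)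
    let e (s : Set X) : F.obj (TopCat.of s) ≅
        (extHomology (p + q)).obj ((singularChains A).obj (TopCat.of s)) :=
      (homologyIntIso A (p + q)).app (TopCat.of s)
    have surj (s) : Function.Surjective (e s).hom :=
      (AddCommGrpCat.epi_iff_surjective _).1 inferInstance
    have inj (s) : Function.Injective (e s).hom :=
      (AddCommGrpCat.mono_iff_injective _).1 inferInstance
    have nat {s t : Set X} (h : s ⊆ t) (x) : (extHomology (p + q)).map
        ((singularChains A).map (subspaceMap h)) ((e s).hom x) =
          (e t).hom (F.map (subspaceMap h) x) :=
      (ConcreteCategory.congr_hom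
        ((homologyIntIso A (p + q)).hom.naturality (subspaceMap h)) x).symm
    have htop : Y (p + r - 1) = Set.univ := h₁ _ (by lia)
    have : IsIso (subspaceInc (Y (p + r - 1))) :=
      ⟨TopCat.ofHom ⟨fun x => ⟨x, htop ▸ Set.mem_univ x⟩, by fun_prop⟩, rfl, rfl⟩
    have hinj : Function.Injective (F.map (subspaceInc (Y (p + r - 1)))) :=
      (AddCommGrpCat.mono_iff_injective _).1 inferInstance
    have hinc {s t : Set X} (h : s ⊆ t) (x) : F.map (subspaceInc s) x =
        F.map (subspaceInc t) (F.map (subspaceMap h) x) := by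
      rw [← ConcreteCategory.comp_apply, ← F.map_comp]
      rfl
    refine nonempty_isoImageQuotient ((e (Y p)).hom ≫ π) (hπ.comp (surj _)) _ _ fun x => ?_
    refine (hπ' _).trans ((surj (Y (p - 1))).exists.trans (exists_congr fun y => ?_))
    rw [hinc (hY (by lia : p ≤ p + r - 1)), hinc (hY (by lia : p - 1 ≤ p + r - 1)), hinj.eq_iff,
      ← (inj _).eq_iff, ← nat, ← nat]
    rfl

end

/-! ### Singular chains of homeomorphic spaces in different universes -/

section

universe w₁ w₂ w₃

/-- Composition of singular simplices with a continuous map, possibly between spaces in different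
universes. -/
def pushSimplex {X : TopCat.{w₁}} {Y : TopCat.{w₂}} (f : C(X, Y)) {n : SimplexCategoryᵒᵖ}
    (σ : (TopCat.toSSet.obj X).obj n) : (TopCat.toSSet.obj Y).obj n :=
  (Y.toSSetObjEquiv n).symm (f.comp (X.toSSetObjEquiv n σ))

/-- The chain map induced by a continuous map, possibly between spaces in different universes. -/
def singularChainsMap (A : AddCommGrpCat.{u}) [HasCoproducts.{w₁} AddCommGrpCat.{u}]
    [HasCoproducts.{w₂} AddCommGrpCat.{u}] {X : TopCat.{w₁}} {Y : TopCat.{w₂}} (f : C(X, Y)) :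
    (TopCat.toSSet.obj X).chainComplex A ⟶ (TopCat.toSSet.obj Y).chainComplex A where
  f n := chainDesc (TopCat.toSSet.obj X) fun σ =>
    (TopCat.toSSet.obj Y).ιChainComplex (pushSimplex f σ)
  comm' i j h := by
    obtain rfl : j + 1 = i := h
    refine SSet.chainComplex_hom_ext (X := TopCat.toSSet.obj X) fun σ => ?_
    rw [← Category.assoc, ι_chainDesc, ← Category.assoc]
    simp only [SSet.ιChainComplex_d, Preadditive.sum_comp, Preadditive.zsmul_comp, ι_chainDesc]
    rfl

lemma ι_singularChainsMap (A : AddCommGrpCat.{u}) [HasCoproducts.{w₁} AddCommGrpCat.{u}]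
    [HasCoproducts.{w₂} AddCommGrpCat.{u}] {X : TopCat.{w₁}} {Y : TopCat.{w₂}} (f : C(X, Y))
    {n : ℕ} (σ : (TopCat.toSSet.obj X) _⦋n⦌) :
    (TopCat.toSSet.obj X).ιChainComplex (R := A) σ ≫ (singularChainsMap.{u, w₁, w₂} A f).f n =
      (TopCat.toSSet.obj Y).ιChainComplex (pushSimplex f σ) :=
  ι_chainDesc _ _ _

lemma singularChainsMap_comp (A : AddCommGrpCat.{u}) [HasCoproducts.{w₁} AddCommGrpCat.{u}]
    [HasCoproducts.{w₂} AddCommGrpCat.{u}] [HasCoproducts.{w₃} AddCommGrpCat.{u}]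
    {X : TopCat.{w₁}} {Y : TopCat.{w₂}} {T : TopCat.{w₃}} (f : C(X, Y)) (g : C(Y, T)) :
    singularChainsMap.{u, w₁, w₂} A f ≫ singularChainsMap.{u, w₂, w₃} A g =
      singularChainsMap.{u, w₁, w₃} A (g.comp f) := by
  ext n : 1
  refine SSet.chainComplex_hom_ext (X := TopCat.toSSet.obj X) fun σ => ?_
  rw [HomologicalComplex.comp_f, ι_singularChainsMap, ← Category.assoc, ι_singularChainsMap,
    ι_singularChainsMap]
  rfl

lemma singularChainsMap_eq_map (A : AddCommGrpCat.{u}) [HasCoproducts.{w₁} AddCommGrpCat.{u}]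
    {X Y : TopCat.{w₁}} (f : X ⟶ Y) :
    singularChainsMap.{u, w₁, w₁} A f.hom = (singularChains.{w₁} A).map f := by
  ext n : 1
  refine SSet.chainComplex_hom_ext (X := TopCat.toSSet.obj X) fun σ => ?_
  rw [ι_singularChainsMap]
  exact (SSet.ι_chainComplexMap_f _ _ (TopCat.toSSet.map f) A σ).symm

/-- A homeomorphism induces an isomorphism of singular chain complexes, also if the two spaces are
in different universes: quotients of spheres are in the lowest universe, but cells are not. -/
def singularChainsIso (A : AddCommGrpCat.{u}) [HasCoproducts.{w₁} AddCommGrpCat.{u}]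
    [HasCoproducts.{w₂} AddCommGrpCat.{u}] {X : TopCat.{w₁}} {Y : TopCat.{w₂}} (e : X ≃ₜ Y) :
    (singularChains.{w₁} A).obj X ≅ (singularChains.{w₂} A).obj Y where
  hom := singularChainsMap.{u, w₁, w₂} A (e : C(X, Y))
  inv := singularChainsMap.{u, w₂, w₁} A (e.symm : C(Y, X))
  hom_inv_id := by
    refine (singularChainsMap_comp.{u, w₁, w₂, w₁} A _ _).trans (Eq.trans ?_
      ((singularChainsMap_eq_map A (𝟙 X)).trans ((singularChains.{w₁} A).map_id X)))
    congr 1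
    ext x
    exact e.symm_apply_apply x
  inv_hom_id := by
    refine (singularChainsMap_comp.{u, w₂, w₁, w₂} A _ _).trans (Eq.trans ?_
      ((singularChainsMap_eq_map A (𝟙 Y)).trans ((singularChains.{w₂} A).map_id Y)))
    congr 1
    ext x
    exact e.apply_symm_apply x

/-- Homeomorphic spaces have isomorphic reduced homology groups. -/
lemma nonempty_reducedHomologyIso (A : AddCommGrpCat.{u}) [HasCoproducts.{w₁} AddCommGrpCat.{u}]
    [HasCoproducts.{w₂} AddCommGrpCat.{u}] {X : TopCat.{w₁}} {Y : TopCat.{w₂}} (e : X ≃ₜ Y)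
    (n : ℤ) :
    Nonempty (reducedHomology.{w₁} A n X ≅ reducedHomology.{w₂} A n Y) := by
  let e₀ : TopCat.of PUnit.{w₁ + 1} ≃ₜ TopCat.of PUnit.{w₂ + 1} :=
    Homeomorph.homeomorphOfUnique _ _
  let c : X ⟶ TopCat.of PUnit.{w₁ + 1} := TopCat.ofHom (ContinuousMap.const X PUnit.unit)
  let c' : Y ⟶ TopCat.of PUnit.{w₂ + 1} := TopCat.ofHom (ContinuousMap.const Y PUnit.unit)
  have hc : (singularChains.{w₁} A).map c ≫ (singularChainsIso.{u, w₁, w₂} A e₀).hom =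
      (singularChainsIso.{u, w₁, w₂} A e).hom ≫ (singularChains.{w₂} A).map c' := by
    rw [← singularChainsMap_eq_map, ← singularChainsMap_eq_map]
    exact (singularChainsMap_comp.{u, w₁, w₁, w₂} A _ _).trans
      (singularChainsMap_comp.{u, w₁, w₂, w₂} A _ _).symm
  let i₁ := (homologyIntIso.{w₁} A n).app X ≪≫
    (extHomology n).mapIso (singularChainsIso.{u, w₁, w₂} A e) ≪≫
      ((homologyIntIso.{w₂} A n).app Y).symm
  let i₂ := (homologyIntIso.{w₁} A n).app (TopCat.of PUnit) ≪≫
    (extHomology n).mapIso (singularChainsIso.{u, w₁, w₂} A e₀) ≪≫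
      ((homologyIntIso.{w₂} A n).app (TopCat.of PUnit)).symm
  refine ⟨kernel.mapIso _ _ i₁ i₂ ?_⟩
  have h₁ := (homologyIntIso.{w₁} A n).hom.naturality c
  have h₂ := (homologyIntIso.{w₂} A n).inv.naturality c'
  have h₃ := congrArg (extHomology n).map hc
  rw [Functor.map_comp, Functor.map_comp] at h₃
  change _ ≫ (homologyIntIso.{w₁} A n).hom.app _ ≫ _ ≫ (homologyIntIso.{w₂} A n).inv.app _ =
    ((homologyIntIso.{w₁} A n).hom.app _ ≫ _ ≫ (homologyIntIso.{w₂} A n).inv.app _) ≫ _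
  change _ = _ ≫ _ at h₁
  rw [Category.assoc, Category.assoc, ← h₂, ← Category.assoc, h₁, Category.assoc]
  congr 1
  change (extHomology n).map _ ≫ _ ≫ _ = _ ≫ (extHomology n).map _ ≫ _
  rw [← Category.assoc, ← Category.assoc]
  exact congrArg (· ≫ _) h₃

end

/-! ### Attaching quotients of balls -/

/-- The data of a space `Y` which is obtained from a closed subspace `W` by attaching quotients of
closed balls by groups of isometries along their boundaries. The characteristic maps are defined on
the whole Euclidean spaces, which avoids subtypes, but only their values on the closed unit balls
matter. The groups need not be finite. -/
structure CellAttachment (Y : Type u) [TopologicalSpace Y] where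
  /-- the subspace to which cells are attached -/
  W : Set Y
  isClosed_W : IsClosed W
  /-- the index type of the cells -/
  I : Type u
  /-- the dimension of a cell -/
  d : I → ℕ
  /-- the group attached to a cell -/
  G : ∀ i, Subgroup (O (d i))
  /-- the characteristic map of a cell -/
  χ : ∀ i, C(E (d i), Y)
  χ_mem : ∀ i v, ‖v‖ = 1 → χ i v ∈ W
  χ_notMem : ∀ i v, ‖v‖ < 1 → χ i v ∉ W
  index_eq : ∀ i j v w, ‖v‖ < 1 → ‖w‖ < 1 → χ i v = χ j w → i = j
  exists_eq : ∀ i v w, ‖v‖ < 1 → ‖w‖ < 1 → χ i v = χ i w → ∃ g ∈ G i, g v = w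
  χ_apply : ∀ i, ∀ g ∈ G i, ∀ v, χ i (g v) = χ i v
  cover : ∀ y ∉ W, ∃ (i : I) (v : E (d i)), ‖v‖ < 1 ∧ χ i v = y
  isClosed_of : ∀ B : Set Y, IsClosed (B ∩ W) →
    (∀ i, IsClosed (Metric.closedBall 0 1 ∩ χ i ⁻¹' B)) → IsClosed B

namespace CellAttachment

variable {Y : Type u} [TopologicalSpace Y] (a : CellAttachment Y)

/-- The sum of `W` and the closed balls. -/
abbrev Pieces : Type u := a.W ⊕ Σ i, ULift.{u} (Metric.closedBall (0 : E (a.d i)) 1)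

/-- The map from the sum of `W` and the closed balls to `Y`. -/
def glue : a.Pieces → Y := Sum.elim Subtype.val fun x => a.χ x.1 x.2.down

lemma isQuotientMap_glue : IsQuotientMap a.glue := by
  have hc : Continuous a.glue := continuous_subtype_val.sumElim (continuous_sigma fun i =>
    (a.χ i).continuous.comp (continuous_subtype_val.comp continuous_uliftDown))
  refine isQuotientMap_iff_isClosed.2 ⟨fun y => ?_, fun B => ⟨fun h => h.preimage hc, fun h => ?_⟩⟩
  · by_cases hy : y ∈ a.W
    · exact ⟨.inl ⟨y, hy⟩, rfl⟩
    · obtain ⟨i, v, hv, rfl⟩ := a.cover y hy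
      exact ⟨.inr ⟨i, ⟨v, mem_closedBall_zero_iff.2 hv.le⟩⟩, rfl⟩
  · rw [isClosed_sum_iff, isClosed_sigma_iff] at h
    refine a.isClosed_of B ?_ fun i => ?_
    · rw [Set.inter_comm, ← Subtype.image_preimage_coe]
      exact a.isClosed_W.isClosedEmbedding_subtypeVal.isClosedMap _ h.1
    · rw [← Subtype.image_preimage_coe]
      exact Metric.isClosed_closedBall.isClosedEmbedding_subtypeVal.isClosedMap _
        ((h.2 i).preimage continuous_uliftUp)

variable {Z : Type*} [TopologicalSpace Z]

/-- A criterion for continuity on an open subset `U` of `Y`, with parameters in `L`: continuity can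
be tested on `W` and on the closed balls. Products with a locally compact space preserve quotient
maps, and `L` is the unit interval in the construction of homotopies. -/
lemma continuousOn_of {L : Type*} [TopologicalSpace L] [LocallyCompactSpace L] {U : Set Y}
    (hU : IsOpen U) {H : L × Y → Z} (hW : ContinuousOn H (Set.univ ×ˢ (U ∩ a.W)))
    (hχ : ∀ i, ContinuousOn (fun p : L × E (a.d i) => H (p.1, a.χ i p.2))
      (Set.univ ×ˢ (Metric.closedBall 0 1 ∩ a.χ i ⁻¹' U))) :
    ContinuousOn H (Set.univ ×ˢ U) := by
  have key : Continuous fun p : L × U => H (p.1, p.2) := by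
    refine (a.isQuotientMap_glue.restrictPreimage_isOpen hU).continuous_lift_prod_right
      (g := fun p : L × U => H (p.1, p.2)) ?_
    change Continuous fun p : L × (a.glue ⁻¹' U) => H (p.1, a.glue p.2)
    have hcont : ContinuousOn (fun p : L × a.Pieces => H (p.1, a.glue p.2))
        (Set.univ ×ˢ (a.glue ⁻¹' U)) := by
      rintro ⟨t, x | ⟨i, x⟩⟩ ⟨-, h⟩
      · refine ContinuousAt.continuousWithinAt ?_
        refine ((IsOpenEmbedding.id (X := L)).prodMap
          (IsOpenEmbedding.inl (X := a.W))).continuousAt_iff (x := (t, x)) |>.1 ?_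
        refine ContinuousOn.continuousAt (s := Set.univ ×ˢ (Subtype.val ⁻¹' U)) ?_ ?_
        · exact hW.comp (f := fun p : L × a.W => (p.1, (p.2 : Y))) (by fun_prop)
            fun p hp => ⟨trivial, hp.2, p.2.2⟩
        · exact (isOpen_univ.prod (hU.preimage continuous_subtype_val)).mem_nhds ⟨trivial, h⟩
      · refine ContinuousAt.continuousWithinAt ?_
        refine ((IsOpenEmbedding.id (X := L)).prodMap (IsOpenEmbedding.inr.comp
          (IsOpenEmbedding.sigmaMk (σ := fun i => ULift.{u} (Metric.closedBall (0 : E (a.d i)) 1))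
            (i := i)))).continuousAt_iff (x := (t, x)) |>.1 ?_
        have hc : Continuous fun y : ULift.{u} (Metric.closedBall (0 : E (a.d i)) 1) =>
            a.χ i y.down := (a.χ i).continuous.comp
              (continuous_subtype_val.comp continuous_uliftDown)
        refine ContinuousOn.continuousAt (s := Set.univ ×ˢ ((fun y => a.χ i y.down) ⁻¹' U)) ?_ ?_
        · exact (hχ i).comp (f := fun p : L × ULift.{u} (Metric.closedBall (0 : E (a.d i)) 1) =>
            (p.1, (p.2.down : E (a.d i)))) (Continuous.continuousOn (continuous_fst.prodMk
              (continuous_subtype_val.comp (continuous_uliftDown.comp continuous_snd))))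
            fun p hp => ⟨trivial, p.2.down.2, hp.2⟩
        · exact (isOpen_univ.prod (hU.preimage hc)).mem_nhds ⟨trivial, h⟩
    refine hcont.comp_continuous (f := fun p : L × (a.glue ⁻¹' U) => (p.1, (p.2 : a.Pieces)))
      (by fun_prop) fun p => ⟨trivial, p.2.2⟩
  rw [continuousOn_iff_continuous_domRestrict]
  exact key.comp (f := fun p : ↥((Set.univ : Set L) ×ˢ U) => (p.1.1, (⟨p.1.2, p.2.2⟩ : U)))
    (by fun_prop)

/-- A map on `Y`, given by its values on `W` and its values on the open balls. A point outside `W`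
has several preimages in its ball, one of which is chosen; for functions `F i` which are invariant
under `G i` the choice does not matter, see `extend_χ`. -/
def extend {Z : Type*} (F₀ : Y → Z) (F : ∀ i, E (a.d i) → Z) (y : Y) : Z :=
  open scoped Classical in
  if h : y ∈ a.W then F₀ y else F (a.cover y h).choose (a.cover y h).choose_spec.choose

lemma extend_of_mem {Z : Type*} (F₀ : Y → Z) (F : ∀ i, E (a.d i) → Z) {y : Y} (hy : y ∈ a.W) :
    a.extend F₀ F y = F₀ y := dif_pos hy

lemma extend_χ {Z : Type*} (F₀ : Y → Z) (F : ∀ i, E (a.d i) → Z) {i : a.I} {v : E (a.d i)}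
    (hv : ‖v‖ ≤ 1) (hF : ∀ g ∈ a.G i, ∀ v, F i (g v) = F i v)
    (h₀ : ‖v‖ = 1 → F₀ (a.χ i v) = F i v) : a.extend F₀ F (a.χ i v) = F i v := by
  obtain hv | hv := hv.eq_or_lt
  · rw [extend_of_mem _ _ _ (a.χ_mem i v hv), h₀ hv]
  · have hy := a.χ_notMem i v hv
    rw [extend, dif_neg hy]
    generalize_proofs h₁ h₂
    obtain ⟨h₃, h₄⟩ := h₂.choose_spec
    have e := a.index_eq _ _ _ _ h₃ hv h₄
    generalize h₂.choose = v' at *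
    generalize h₁.choose = i' at *
    subst e
    obtain ⟨g, hg, rfl⟩ := a.exists_eq _ _ _ h₃ hv h₄
    exact (hF g hg v').symm

/-- The open cell with index `i`. -/
def openCell (i : a.I) : Set Y := a.χ i '' Metric.ball 0 1

/-- The complement of the centers of the cells. -/
def punctured : Set Y := {y | ∀ i, a.χ i 0 ≠ y}

lemma χ_mem_openCell {i j : a.I} {v : E (a.d i)} (hv : ‖v‖ ≤ 1) :
    a.χ i v ∈ a.openCell j ↔ i = j ∧ ‖v‖ < 1 := by
  constructor
  · rintro ⟨w, hw, h⟩
    rw [mem_ball_zero_iff] at hw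
    have hv' : ‖v‖ < 1 := hv.lt_of_ne fun h' => a.χ_notMem j w hw (h ▸ a.χ_mem i v h')
    exact ⟨(a.index_eq j i w v hw hv' h).symm, hv'⟩
  · rintro ⟨rfl, h⟩
    exact ⟨v, mem_ball_zero_iff.2 h, rfl⟩

lemma χ_mem_punctured {i : a.I} {v : E (a.d i)} (hv : ‖v‖ ≤ 1) :
    a.χ i v ∈ a.punctured ↔ v ≠ 0 := by
  constructor
  · rintro h rfl
    exact h i rfl
  · rintro h j hj
    have h0 : ‖(0 : E (a.d j))‖ < 1 := by simp
    have hv' : ‖v‖ < 1 := hv.lt_of_ne fun h' => a.χ_notMem j 0 h0 (hj ▸ a.χ_mem i v h')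
    obtain rfl := a.index_eq j i _ _ h0 hv' hj
    obtain ⟨g, -, hg⟩ := a.exists_eq _ _ _ h0 hv' hj
    exact h (by rw [← hg, map_zero])

lemma W_subset_punctured : a.W ⊆ a.punctured := fun y hy i h =>
  a.χ_notMem i 0 (by simp) (h ▸ hy)

lemma isOpen_punctured : IsOpen a.punctured := by
  rw [← isClosed_compl_iff]
  refine a.isClosed_of _ ?_ fun i => ?_
  · convert isClosed_empty
    rw [← Set.disjoint_iff_inter_eq_empty, Set.disjoint_compl_left_iff_subset]
    exact a.W_subset_punctured
  · convert isClosed_singleton (x := (0 : E (a.d i)))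
    ext v
    simp only [Set.mem_inter_iff, Set.mem_preimage, Set.mem_compl_iff, mem_closedBall_zero_iff,
      Set.mem_singleton_iff]
    refine ⟨fun h => ?_, ?_⟩
    · simpa [a.χ_mem_punctured h.1] using h.2
    · rintro rfl
      simp [a.χ_mem_punctured]

lemma disjoint_openCell_W (i : a.I) : Disjoint (a.openCell i) a.W := by
  rw [Set.disjoint_left]
  rintro _ ⟨v, hv, rfl⟩
  exact a.χ_notMem i v (mem_ball_zero_iff.1 hv)

lemma isOpen_openCell (i : a.I) : IsOpen (a.openCell i) := by
  rw [← isClosed_compl_iff]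
  refine a.isClosed_of _ ?_ fun j => ?_
  · convert a.isClosed_W
    rw [Set.inter_eq_right]
    exact (a.disjoint_openCell_W i).symm.subset_compl_right
  · by_cases h : j = i
    · subst h
      suffices h : Metric.closedBall 0 1 ∩ a.χ j ⁻¹' (a.openCell j)ᶜ = Metric.sphere 0 1 from
        h ▸ Metric.isClosed_sphere
      ext v
      simp only [Set.mem_inter_iff, Set.mem_preimage, Set.mem_compl_iff, mem_closedBall_zero_iff,
        mem_sphere_zero_iff_norm]
      refine ⟨fun h => ?_, fun h => ?_⟩
      · simpa [a.χ_mem_openCell h.1, h.1.ge_iff_eq] using h.2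
      · simp [a.χ_mem_openCell h.le, h]
    · rw [Set.inter_eq_left.2]
      · exact Metric.isClosed_closedBall
      intro v hv h'
      exact h ((a.χ_mem_openCell (mem_closedBall_zero_iff.1 hv)).1 h').1

lemma openCell_inter_openCell {i j : a.I} (h : i ≠ j) : a.openCell i ∩ a.openCell j = ∅ := by
  ext y
  simp only [Set.mem_inter_iff, Set.mem_empty_iff_false, iff_false, not_and]
  rintro ⟨v, hv, rfl⟩ h'
  exact h ((a.χ_mem_openCell (mem_ball_zero_iff.1 hv).le).1 h').1

lemma punctured_union_openCell : a.punctured ∪ ⋃ i, a.openCell i = Set.univ := by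
  rw [Set.eq_univ_iff_forall]
  intro y
  by_cases hy : y ∈ a.W
  · exact .inl (a.W_subset_punctured hy)
  · obtain ⟨i, v, hv, rfl⟩ := a.cover y hy
    exact .inr (Set.mem_iUnion.2 ⟨i, v, mem_ball_zero_iff.2 hv, rfl⟩)

/-! ### Radial homotopies -/

open unitInterval

/-- The radial homotopy, which moves the points of all cells along the rays from the centers
until, at time `0`, they have distance `c` from the center. The values `c = 1`, `c = 0` and
`c = 1 / 2` are used to push the complement of the centers to `W`, to contract the open cells, and
to push the punctured open cells to spheres. Centers do not move, as multiples of the zero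
vector are zero; on `W` the homotopy is constant, which fits continuously only for `c = 1`. -/
def radial (c : ℝ) (p : I × Y) : Y :=
  a.extend id (fun i v => a.χ i (((p.1 : ℝ) + (1 - p.1) * (c / ‖v‖)) • v)) p.2

lemma radial_of_mem (c : ℝ) (t : I) {y : Y} (hy : y ∈ a.W) : a.radial c (t, y) = y :=
  a.extend_of_mem _ _ hy

lemma radial_χ (c : ℝ) (t : I) {i : a.I} {v : E (a.d i)} (hv : ‖v‖ ≤ 1) (hc : c = 1 ∨ ‖v‖ < 1) :
    a.radial c (t, a.χ i v) = a.χ i (((t : ℝ) + (1 - t) * (c / ‖v‖)) • v) := by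
  refine a.extend_χ id (fun i v => a.χ i (((t : ℝ) + (1 - t) * (c / ‖v‖)) • v)) hv
    (fun g hg v => ?_) fun h => ?_
  · rw [g.norm_map, ← map_smul]
    exact a.χ_apply i g hg _
  · rw [h, hc.resolve_right h.not_lt]
    simp

lemma norm_radial {c : ℝ} (hc : 0 ≤ c) (t : I) {n : ℕ} {v : E n} (hv : v ≠ 0) :
    ‖((t : ℝ) + (1 - t) * (c / ‖v‖)) • v‖ = t * ‖v‖ + (1 - t) * c := by
  have h1 : 0 ≤ 1 - (t : ℝ) := sub_nonneg.2 t.2.2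
  have h2 : 0 ≤ (t : ℝ) := t.2.1
  have h3 : 0 < ‖v‖ := norm_pos_iff.2 hv
  rw [norm_smul, Real.norm_of_nonneg (by positivity)]
  field_simp

lemma radial_zero {c : ℝ} {i : a.I} {v : E (a.d i)} (hv : ‖v‖ ≤ 1) (hc : c = 1 ∨ ‖v‖ < 1) :
    a.radial c (0, a.χ i v) = a.χ i ((c / ‖v‖) • v) := by
  rw [radial_χ _ _ _ hv hc]
  simp

lemma radial_one (c : ℝ) (y : Y) (hy : c = 1 ∨ y ∉ a.W) : a.radial c (1, y) = y := by
  by_cases h : y ∈ a.W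
  · exact a.radial_of_mem _ _ h
  · obtain ⟨i, v, hv, rfl⟩ := a.cover y h
    rw [radial_χ _ _ _ hv.le (.inr hv)]
    simp

lemma continuousOn_radial (c : ℝ) {U : Set Y} (hU : IsOpen U) (hc : c = 1 ∨ Disjoint U a.W)
    (h₀ : c = 0 ∨ U ⊆ a.punctured) : ContinuousOn (a.radial c) (Set.univ ×ˢ U) := by
  refine a.continuousOn_of hU ?_ fun i => ?_
  · exact continuousOn_snd.congr fun p hp => a.radial_of_mem _ _ hp.2.2
  · have hcont : ContinuousOn (fun p : I × E (a.d i) =>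
        a.χ i (((p.1 : ℝ) + (1 - p.1) * (c / ‖p.2‖)) • p.2))
        (Set.univ ×ˢ (Metric.closedBall 0 1 ∩ a.χ i ⁻¹' U)) := by
      suffices h : ContinuousOn (fun p : I × E (a.d i) => (p.1 : ℝ) + (1 - p.1) * (c / ‖p.2‖))
          (Set.univ ×ˢ (Metric.closedBall 0 1 ∩ a.χ i ⁻¹' U)) from
        (a.χ i).continuous.comp_continuousOn (h.smul continuousOn_snd)
      refine ContinuousOn.add (by fun_prop) (ContinuousOn.mul (by fun_prop) ?_)
      obtain rfl | h₀ := h₀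
      · simpa using continuousOn_const
      · refine continuousOn_const.div (by fun_prop) fun p hp => norm_ne_zero_iff.2 ?_
        exact (a.χ_mem_punctured (mem_closedBall_zero_iff.1 hp.2.1)).1 (h₀ hp.2.2)
    refine hcont.congr fun p hp => ?_
    have hp1 := mem_closedBall_zero_iff.1 hp.2.1
    refine a.radial_χ c p.1 hp1 (hc.imp_right fun h => hp1.lt_of_ne fun h' => ?_)
    exact Set.disjoint_left.1 h hp.2.2 (a.χ_mem i _ h')

end CellAttachment

/-! ### The pairs of spaces in an attachment, up to homotopy -/

/-- The restriction of a family of self-maps of a space to a subspace. -/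
def homotopyOn {X : Type u} [TopologicalSpace X] {s : Set X} (H : unitInterval × X → X)
    (hc : ContinuousOn H (Set.univ ×ˢ s)) (hs : ∀ t, ∀ x ∈ s, H (t, x) ∈ s) :
    C(unitInterval × s, s) where
  toFun p := ⟨H (p.1, p.2), hs _ _ p.2.2⟩
  continuous_toFun := Continuous.subtype_mk (hc.comp_continuous
    (f := fun p : unitInterval × s => (p.1, (p.2 : X))) (by fun_prop) fun p => ⟨trivial, p.2.2⟩) _

namespace CellAttachment

open unitInterval

variable {Y : Type u} [TopologicalSpace Y] (a : CellAttachment Y)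

lemma radial_mem_punctured {c : ℝ} (hc : 0 < c) (hc' : c ≤ 1) (t : I) {y : Y}
    (h : c = 1 ∨ y ∉ a.W) (hy : y ∈ a.punctured) : a.radial c (t, y) ∈ a.punctured := by
  by_cases hW : y ∈ a.W
  · rwa [a.radial_of_mem _ _ hW]
  · obtain ⟨i, v, hv, rfl⟩ := a.cover y hW
    have hv0 := (a.χ_mem_punctured hv.le).1 hy
    have h1 : 0 ≤ 1 - (t : ℝ) := sub_nonneg.2 t.2.2
    have h2 : 0 ≤ (t : ℝ) := t.2.1
    have h3 : 0 < ‖v‖ := norm_pos_iff.2 hv0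
    rw [radial_χ _ _ _ hv.le (.inr hv), χ_mem_punctured, ← norm_pos_iff,
      norm_radial hc.le _ hv0]
    · obtain h | h := h2.eq_or_lt
      · rw [← h]
        linarith
      · positivity
    · rw [norm_radial hc.le _ hv0]
      nlinarith

lemma radial_mem_openCell {c : ℝ} (hc : 0 ≤ c) (hc' : c < 1) (t : I) {y : Y} {i : a.I}
    (hy : y ∈ a.openCell i) : a.radial c (t, y) ∈ a.openCell i := by
  obtain ⟨v, hv, rfl⟩ := hy
  rw [mem_ball_zero_iff] at hv
  have h1 : 0 ≤ 1 - (t : ℝ) := sub_nonneg.2 t.2.2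
  have h2 : 0 ≤ (t : ℝ) := t.2.1
  rw [radial_χ _ _ _ hv.le (.inr hv)]
  refine ⟨_, ?_, rfl⟩
  rw [mem_ball_zero_iff]
  by_cases hv0 : v = 0
  · simp [hv0]
  · rw [norm_radial hc _ hv0]
    obtain h | h := h2.eq_or_lt
    · rw [← h]
      linarith
    · nlinarith

variable (A : AddCommGrpCat.{u})

/-- The inclusion of `W` in the complement of the centers is a homotopy equivalence. -/
lemma quasiIso_W_punctured :
    QuasiIso ((singularChains A).map (subspaceMap a.W_subset_punctured)) := by
  let H := homotopyOn (a.radial 1) (a.continuousOn_radial 1 a.isOpen_punctured (.inl rfl)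
    (.inr subset_rfl)) fun t y hy => a.radial_mem_punctured one_pos le_rfl t (.inl rfl) hy
  have hW (y : a.punctured) : (H (0, y) : Y) ∈ a.W := by
    change a.radial 1 (0, (y : Y)) ∈ a.W
    by_cases hW : (y : Y) ∈ a.W
    · rwa [a.radial_of_mem _ _ hW]
    · obtain ⟨i, v, hv, hvy⟩ := a.cover y hW
      have hv0 := (a.χ_mem_punctured hv.le).1 (hvy ▸ y.2)
      rw [← hvy, radial_zero _ hv.le (.inl rfl)]
      apply a.χ_mem
      rw [norm_smul, norm_div, norm_norm, norm_one, one_div,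
        inv_mul_cancel₀ (norm_ne_zero_iff.2 hv0)]
  let g : TopCat.of a.punctured ⟶ TopCat.of a.W := TopCat.ofHom
    ⟨fun y => ⟨H (0, y), hW y⟩, by fun_prop⟩
  have hfg : subspaceMap a.W_subset_punctured ≫ g = 𝟙 _ := by
    ext y
    exact a.radial_of_mem 1 0 y.2
  refine quasiIso_of_homotopy A (subspaceMap a.W_subset_punctured) g
    (hfg ▸ ContinuousMap.Homotopy.refl _) ?_
  exact
    { toContinuousMap := H
      map_zero_left := fun y => rfl
      map_one_left := fun y => Subtype.ext (a.radial_one 1 y (.inl rfl)) }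

/-- The open cells are contractible. -/
lemma quasiIso_openCell (i : a.I) : QuasiIso ((singularChains A).map
    (TopCat.ofHom (ContinuousMap.const (TopCat.of (a.openCell i)) PUnit.unit) :
      TopCat.of (a.openCell i) ⟶ TopCat.of PUnit.{u + 1})) := by
  let H := homotopyOn (a.radial 0) (a.continuousOn_radial 0 (a.isOpen_openCell i)
    (.inr (a.disjoint_openCell_W i)) (.inl rfl)) fun t y hy =>
      a.radial_mem_openCell le_rfl one_pos t hy
  let x : a.openCell i := ⟨a.χ i 0, 0, by simp, rfl⟩
  let g : TopCat.of PUnit.{u + 1} ⟶ TopCat.of (a.openCell i) :=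
    TopCat.ofHom (ContinuousMap.const _ x)
  refine quasiIso_of_homotopy A _ g ?_ (ContinuousMap.Homotopy.refl _)
  exact
    { toContinuousMap := H
      map_zero_left := fun y => Subtype.ext (by
        obtain ⟨_, v, hv, rfl⟩ := y
        rw [mem_ball_zero_iff] at hv
        refine (a.radial_zero hv.le (.inr hv)).trans ?_
        rw [zero_div, zero_smul]
        rfl)
      map_one_left := fun y => Subtype.ext (a.radial_one 0 y
        (.inr (Set.disjoint_left.1 (a.disjoint_openCell_W i) y.2))) }

/-- The class of the direction of a nonzero vector in the quotient of the unit sphere; an arbitrary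
point for the zero vector. -/
def direction {n : ℕ} (G : Subgroup (O n)) [Nonempty (OrbitSpace G (Metric.sphere 0 1))] (v : E n) :
    OrbitSpace G (Metric.sphere 0 1) :=
  open scoped Classical in
  if h : v ≠ 0 then ⟦⟨‖v‖⁻¹ • v, by
    rw [mem_sphere_zero_iff_norm, norm_smul, norm_inv, norm_norm,
      inv_mul_cancel₀ (norm_ne_zero_iff.2 h)]⟩⟧
  else Classical.arbitrary _

section

variable {n : ℕ} (G : Subgroup (O n)) [Nonempty (OrbitSpace G (Metric.sphere 0 1))]

lemma direction_smul {v : E n} (hv : ‖v‖ = 1) {c : ℝ} (hc : 0 < c) :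
    direction G (c • v) = ⟦⟨v, mem_sphere_zero_iff_norm.2 hv⟩⟧ := by
  have hv0 : v ≠ 0 := by
    rintro rfl
    simp at hv
  rw [direction, dif_pos (smul_ne_zero hc.ne' hv0)]
  congr 2
  rw [norm_smul, hv, Real.norm_of_nonneg hc.le, mul_one, inv_smul_smul₀ hc.ne']

lemma direction_apply {v : E n} (g : O n) (hg : g ∈ G) : direction G (g v) = direction G v := by
  by_cases hv : v = 0
  · simp [hv]
  · have hgv : g v ≠ 0 := by simpa using hv
    rw [direction, direction, dif_pos hv, dif_pos hgv]
    refine (Quotient.sound (s := orbitSetoid G (Metric.sphere 0 1)) ?_).symm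
    refine ⟨g, hg, ?_⟩
    change g (‖v‖⁻¹ • v) = ‖g v‖⁻¹ • g v
    rw [g.norm_map, map_smul]

lemma continuousOn_direction : ContinuousOn (direction G) {0}ᶜ := by
  let φ (v : ({0}ᶜ : Set (E n))) : Metric.sphere (0 : E n) 1 := ⟨‖(v : E n)‖⁻¹ • (v : E n), by
    rw [mem_sphere_zero_iff_norm, norm_smul, norm_inv, norm_norm,
      inv_mul_cancel₀ (norm_ne_zero_iff.2 v.2)]⟩
  have hφ : Continuous φ := Continuous.subtype_mk
    ((continuous_subtype_val.norm.inv₀ fun v => norm_ne_zero_iff.2 v.2).smul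
      continuous_subtype_val) _
  rw [continuousOn_iff_continuous_domRestrict]
  have h : ({0}ᶜ : Set (E n)).domRestrict (direction G) =
      Quotient.mk (orbitSetoid G (Metric.sphere 0 1)) ∘ φ := by
    ext v
    exact dif_pos v.2
  rw [h]
  exact continuous_quotient_mk'.comp hφ

end

/-- The punctured open cells are homotopy equivalent to quotients of spheres. -/
lemma exists_quasiIso_sphere (i : a.I) [Nonempty (OrbitSpace (a.G i) (Metric.sphere 0 1))] :
    ∃ f : TopCat.of (ULift.{u} (OrbitSpace (a.G i) (Metric.sphere 0 1))) ⟶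
      TopCat.of ↑(a.openCell i ∩ a.punctured), QuasiIso ((singularChains A).map f) := by
  let P := a.openCell i ∩ a.punctured
  have hP : IsOpen P := (a.isOpen_openCell i).inter a.isOpen_punctured
  have hPW : Disjoint P a.W := (a.disjoint_openCell_W i).mono_left Set.inter_subset_left
  have hmemP {v : E (a.d i)} (hv : ‖v‖ < 1) : a.χ i v ∈ P ↔ v ≠ 0 :=
    (and_iff_right ((a.χ_mem_openCell hv.le).2 ⟨rfl, hv⟩)).trans (a.χ_mem_punctured hv.le)
  have hhalf {v : E (a.d i)} (hv : ‖v‖ = 1) : ‖(1 / 2 : ℝ) • v‖ = 1 / 2 := by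
    rw [norm_smul, hv]
    norm_num
  let H := homotopyOn (a.radial (1 / 2)) (a.continuousOn_radial (1 / 2) hP (.inr hPW)
    (.inr Set.inter_subset_right)) fun t y hy =>
      ⟨a.radial_mem_openCell (by norm_num) (by norm_num) t hy.1,
        a.radial_mem_punctured (by norm_num) (by norm_num) t
          (.inr (Set.disjoint_left.1 hPW hy)) hy.2⟩
  -- the inclusion of the sphere of radius `1 / 2`
  let f₀ : OrbitSpace (a.G i) (Metric.sphere 0 1) → P :=
    Quotient.lift (fun v => ⟨a.χ i ((1 / 2 : ℝ) • (v : E (a.d i))), by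
      have := hhalf (mem_sphere_zero_iff_norm.1 v.2)
      rw [hmemP (by rw [this]; norm_num), ← norm_pos_iff, this]
      norm_num⟩) (by
      rintro v w ⟨g, hg, h⟩
      ext1
      change a.χ i _ = a.χ i _
      rw [← h, ← map_smul, a.χ_apply i g hg])
  have hf₀ : Continuous f₀ := Continuous.quotient_lift (by fun_prop) _
  -- the projection along the rays from the center, with arbitrary values outside the open cell
  let g₀ : Y → OrbitSpace (a.G i) (Metric.sphere 0 1) :=
    open scoped Classical in
    fun y => if h : ∃ v, ‖v‖ < 1 ∧ a.χ i v = y then direction (a.G i) h.choose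
      else Classical.arbitrary _
  have hg₀ {v : E (a.d i)} (hv : ‖v‖ < 1) : g₀ (a.χ i v) = direction (a.G i) v := by
    have h : ∃ w, ‖w‖ < 1 ∧ a.χ i w = a.χ i v := ⟨v, hv, rfl⟩
    obtain ⟨g, hg, h'⟩ := a.exists_eq i _ _ h.choose_spec.1 hv h.choose_spec.2
    exact (dif_pos h).trans ((direction_apply _ g hg).symm.trans (congrArg _ h'))
  -- no parameter is needed here: take the one-point space
  have hgc : ContinuousOn (fun p : PUnit.{1} × Y => g₀ p.2) (Set.univ ×ˢ P) := by
    refine a.continuousOn_of hP ?_ fun j => ?_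
    · rw [hPW.inter_eq, Set.prod_empty]
      exact continuousOn_empty _
    · by_cases hj : j = i
      · subst hj
        have hlt {p : PUnit.{1} × E (a.d j)} (hp : p ∈ (Set.univ : Set PUnit.{1}) ×ˢ
            (Metric.closedBall 0 1 ∩ a.χ j ⁻¹' P)) : ‖p.2‖ < 1 :=
          ((a.χ_mem_openCell (mem_closedBall_zero_iff.1 hp.2.1)).1 hp.2.2.1).2
        refine ((continuousOn_direction (a.G j)).comp (f := Prod.snd) continuousOn_snd
          fun p hp => ?_).congr fun p hp => hg₀ (hlt hp)
        exact (hmemP (hlt hp)).1 hp.2.2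
      · refine (continuousOn_empty _).mono ?_
        rintro p ⟨-, hp, hp', -⟩
        exact hj ((a.χ_mem_openCell (mem_closedBall_zero_iff.1 hp)).1 hp').1
  let f : TopCat.of (ULift.{u} (OrbitSpace (a.G i) (Metric.sphere 0 1))) ⟶ TopCat.of P :=
    TopCat.ofHom ⟨fun x => f₀ x.down, hf₀.comp continuous_uliftDown⟩
  let g : TopCat.of P ⟶ TopCat.of (ULift.{u} (OrbitSpace (a.G i) (Metric.sphere 0 1))) :=
    TopCat.ofHom ⟨fun y => ULift.up (g₀ y), continuous_uliftUp.comp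
      (hgc.comp_continuous (f := fun y : P => (PUnit.unit, (y : Y))) (by fun_prop)
        fun y => ⟨trivial, y.2⟩)⟩
  have hfg : f ≫ g = 𝟙 _ := by
    ext ⟨x⟩
    induction x using Quotient.inductionOn with | h v => ?_
    have hv := mem_sphere_zero_iff_norm.1 v.2
    refine (hg₀ (by rw [hhalf hv]; norm_num)).trans ?_
    exact direction_smul _ hv (by norm_num)
  refine ⟨f, quasiIso_of_homotopy A f g (hfg ▸ ContinuousMap.Homotopy.refl _) ?_⟩
  exact
    { toContinuousMap := H
      map_zero_left := fun y => Subtype.ext (by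
        obtain ⟨_, ⟨v, hv, rfl⟩, h⟩ := y
        rw [mem_ball_zero_iff] at hv
        have hv0 := (a.χ_mem_punctured hv.le).1 h
        refine (a.radial_zero hv.le (.inr hv)).trans ?_
        change _ = (f₀ (g₀ (a.χ i v)) : Y)
        rw [hg₀ hv, direction, dif_pos hv0]
        change _ = a.χ i _
        rw [smul_smul, div_eq_mul_inv])
      map_one_left := fun y => Subtype.ext (a.radial_one _ y
        (.inr (Set.disjoint_left.1 hPW y.2))) }

end CellAttachment

/-! ### The relative homology of an attachment -/

/-- Reduced homology is invariant under quasi-isomorphisms of singular chains. -/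
lemma nonempty_reducedHomologyIso_of_quasiIso (A : AddCommGrpCat.{u}) {X Y : TopCat.{u}} (f : X ⟶ Y)
    (hf : QuasiIso ((singularChains A).map f)) (n : ℤ) :
    Nonempty (reducedHomology A n X ≅ reducedHomology A n Y) := by
  have : IsIso ((homologyInt A n).map f) :=
    ((NatIso.isIso_map_iff (homologyIntIso A n) f).2 (inferInstanceAs
      (IsIso ((extHomology n).map ((singularChains A).map f)))))
  exact ⟨kernel.mapIso _ _ (asIso ((homologyInt A n).map f)) (Iso.refl _) (by
    rw [Iso.refl_hom, Category.comp_id]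
    exact (homologyInt A n).map_comp _ _)⟩

namespace CellAttachment

variable {Y : Type u} [TopologicalSpace Y] (a : CellAttachment Y) (A : AddCommGrpCat.{u})

/-- If `Y` is obtained from `W` by attaching quotients of balls, the homology of `Y` relative to
`W` is the direct sum of the reduced homology groups of the quotients of the boundary spheres. -/
theorem nonempty_relativeIso (hd : ∀ i, 1 ≤ a.d i) (n : ℤ) :
    Nonempty ((extHomology n).obj (cokernel ((singularChains A).map (subspaceInc a.W))) ≅
      ∐ fun i => reducedHomology A (n - 1)
        (TopCat.of (OrbitSpace (a.G i) (Metric.sphere 0 1)))) := by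
  have hne (i : a.I) : Nonempty (OrbitSpace (a.G i) (Metric.sphere 0 1)) := by
    have : Nontrivial (E (a.d i)) := by
      have : Nonempty (Fin (a.d i)) := ⟨⟨0, hd i⟩⟩
      infer_instance
    obtain ⟨v, hv⟩ := (NormedSpace.sphere_nonempty (x := (0 : E (a.d i))) (r := 1)).2 zero_le_one
    exact ⟨⟦⟨v, hv⟩⟧⟩
  have := a.quasiIso_W_punctured A
  have : QuasiIso (cokernel.map ((singularChains A).map (subspaceInc a.W))
      ((singularChains A).map (subspaceInc a.punctured))
      ((singularChains A).map (subspaceMap a.W_subset_punctured)) (𝟙 _) (by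
        rw [Category.comp_id, ← Functor.map_comp]
        rfl)) := quasiIso_cokernelMap _ _ _ _ _
  let e₁ := asIso ((extHomology n).map (cokernel.map ((singularChains A).map (subspaceInc a.W))
      ((singularChains A).map (subspaceInc a.punctured))
      ((singularChains A).map (subspaceMap a.W_subset_punctured)) (𝟙 _) (by
        rw [Category.comp_id, ← Functor.map_comp]
        rfl)))
  obtain ⟨e₂⟩ := nonempty_excisionIso A a.punctured a.isOpen_punctured a.openCell
    a.isOpen_openCell a.punctured_union_openCell (fun i j h => by
      simp [a.openCell_inter_openCell h]) n
  have e₃ (i : a.I) : Nonempty ((extHomology n).obj (cokernel ((singularChains A).map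
        (subspaceMap (Set.inter_subset_left : a.openCell i ∩ a.punctured ⊆ a.openCell i)))) ≅
      reducedHomology A (n - 1) (TopCat.of (OrbitSpace (a.G i) (Metric.sphere 0 1)))) := by
    obtain ⟨f, hf⟩ := a.exists_quasiIso_sphere A i
    obtain ⟨e⟩ := nonempty_relIsoReducedHomology A (subspaceMap
      (Set.inter_subset_left : a.openCell i ∩ a.punctured ⊆ a.openCell i))
      (f (ULift.up (hne i).some)) (a.quasiIso_openCell A i) n
    obtain ⟨e'⟩ := nonempty_reducedHomologyIso_of_quasiIso A f hf (n - 1)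
    obtain ⟨e''⟩ := nonempty_reducedHomologyIso A
      (X := TopCat.of (ULift.{u} (OrbitSpace (a.G i) (Metric.sphere 0 1))))
      (Y := TopCat.of (OrbitSpace (a.G i) (Metric.sphere 0 1))) Homeomorph.ulift (n - 1)
    exact ⟨e ≪≫ e'.symm ≪≫ e''⟩
  exact ⟨e₁ ≪≫ e₂ ≪≫ Sigma.mapIso fun i => (e₃ i).some⟩

end CellAttachment

/-! ### Cell attachments in symmetric CW-complexes -/

namespace SymmetricCWComplex

variable {X : Type u} [TopologicalSpace X] [T2Space X] (S : SymmetricCWComplex X)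

/-- The radial retraction of Euclidean space to the closed unit ball. -/
def ballRetraction (n : ℕ) : C(E n, Metric.closedBall (0 : E n) 1) where
  toFun v := ⟨(max 1 ‖v‖)⁻¹ • v, by
    have h : 0 < max 1 ‖v‖ := lt_max_of_lt_left one_pos
    rw [mem_closedBall_zero_iff, norm_smul, norm_inv, Real.norm_of_nonneg h.le,
      inv_mul_le_one₀ h]
    exact le_max_right _ _⟩
  continuous_toFun := by
    have h : Continuous fun v : E n => (max 1 ‖v‖)⁻¹ :=
      (continuous_const.max continuous_norm).inv₀ fun v => (lt_max_of_lt_left one_pos).ne'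
    exact (h.smul continuous_id).subtype_mk _

lemma ballRetraction_of_le {n : ℕ} {v : E n} (hv : ‖v‖ ≤ 1) :
    ballRetraction n v = ⟨v, mem_closedBall_zero_iff.2 hv⟩ := by
  ext1
  change (max 1 ‖v‖)⁻¹ • v = v
  rw [max_eq_left hv, inv_one, one_smul]

/-- The characteristic map of a cell, precomposed with the quotient map of the closed unit ball and
the radial retraction to it, as `CellAttachment` asks for a map on the whole Euclidean space. -/
def charMap (i : S.Cell) : C(E (S.dim i), X) :=
  (S.char i).comp ⟨fun v => ⟦ballRetraction _ v⟧,
    continuous_quotient_mk'.comp (ballRetraction _).continuous⟩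

lemma charMap_apply (i : S.Cell) (g) (hg : g ∈ S.G i) (v : E (S.dim i)) :
    S.charMap i (g v) = S.charMap i v := by
  refine congrArg (S.char i) (Quotient.sound (s := orbitSetoid _ _) ?_).symm
  refine ⟨g, hg, ?_⟩
  change g ((max 1 ‖v‖)⁻¹ • v) = (max 1 ‖g v‖)⁻¹ • g v
  rw [g.norm_map, map_smul]

lemma charMap_eq_incl (i : S.Cell) {v : E (S.dim i)} (hv : ‖v‖ < 1) :
    S.charMap i v = (S.char i ∘ OrbitSpace.incl (S.G i) Metric.ball_subset_closedBall)
      ⟦⟨v, mem_ball_zero_iff.2 hv⟩⟧ := by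
  change S.char i ⟦ballRetraction _ v⟧ = _
  rw [ballRetraction_of_le hv.le]
  rfl

lemma charMap_mem_range (i : S.Cell) (v : E (S.dim i)) : S.charMap i v ∈ Set.range (S.char i) :=
  ⟨_, rfl⟩

lemma image_closedBall (i : S.Cell) :
    S.charMap i '' Metric.closedBall 0 1 = Set.range (S.char i) := by
  ext x
  constructor
  · rintro ⟨v, -, rfl⟩
    exact S.charMap_mem_range i v
  · rintro ⟨q, rfl⟩
    induction q using Quotient.inductionOn with | h v => ?_
    refine ⟨v, v.2, ?_⟩
    change S.char i ⟦ballRetraction _ v⟧ = _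
    rw [ballRetraction_of_le (mem_closedBall_zero_iff.1 v.2)]

lemma image_ball (i : S.Cell) : S.charMap i '' Metric.ball 0 1 = S.cell i := by
  rw [← S.range_char i]
  ext x
  constructor
  · rintro ⟨v, hv, rfl⟩
    exact ⟨_, (S.charMap_eq_incl i (mem_ball_zero_iff.1 hv)).symm⟩
  · rintro ⟨q, rfl⟩
    induction q using Quotient.inductionOn with | h v => ?_
    exact ⟨v, v.2, S.charMap_eq_incl i (mem_ball_zero_iff.1 v.2)⟩

lemma charMap_mem_cell (i : S.Cell) {v : E (S.dim i)} (hv : ‖v‖ < 1) : S.charMap i v ∈ S.cell i :=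
  S.image_ball i ▸ ⟨v, mem_ball_zero_iff.2 hv, rfl⟩

lemma exists_eq_of_charMap_eq (i : S.Cell) {v w : E (S.dim i)} (hv : ‖v‖ < 1) (hw : ‖w‖ < 1)
    (h : S.charMap i v = S.charMap i w) : ∃ g ∈ S.G i, g v = w := by
  rw [S.charMap_eq_incl i hv, S.charMap_eq_incl i hw] at h
  exact Quotient.exact ((S.isEmbedding_char i).injective h)

lemma isClosed_range_char (i : S.Cell) : IsClosed (Set.range (S.char i)) := by
  rw [← S.image_closedBall i]
  exact ((isCompact_closedBall _ _).image (S.charMap i).continuous).isClosed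

lemma closure_cell_subset (i : S.Cell) : closure (S.cell i) ⊆ Set.range (S.char i) := by
  refine closure_minimal ?_ (S.isClosed_range_char i)
  rw [← S.image_ball i, ← S.image_closedBall i]
  exact Set.image_mono Metric.ball_subset_closedBall

lemma exists_mem_cell (x : X) : ∃ i, x ∈ S.cell i := by
  simpa using S.cover.ge (Set.mem_univ x)

lemma eq_of_mem_cell {i j : S.Cell} {x : X} (hi : x ∈ S.cell i) (hj : x ∈ S.cell j) : i = j := by
  by_contra h
  exact Set.disjoint_left.1 (S.disjoint h) hi hj

/-- The characteristic map sends boundary points outside the open cell: it is an embedding on the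
quotient of the open ball, so points near the boundary stay away from any given point of the
cell. -/
lemma charMap_notMem_cell (i : S.Cell) {v : E (S.dim i)} (hv : ‖v‖ = 1) :
    S.charMap i v ∉ S.cell i := by
  rw [← S.image_ball i]
  rintro ⟨w, hw, h⟩
  rw [mem_ball_zero_iff] at hw
  -- Suppose that `v` has the same image as `w` in the open ball, and let `‖w‖ < r < 1`. The points
  -- of norm `< r` in the open ball form the preimage of an open set `U`. Then the image of `t • v`
  -- lies in `U` for `t < 1` close to `1`, so `t < r`: a contradiction.
  let N : OrbitSpace (S.G i) (Metric.ball 0 1) → ℝ :=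
    Quotient.lift (fun v => ‖(v : E (S.dim i))‖) (by
      rintro v w ⟨g, -, h⟩
      rw [← h, g.norm_map])
  have hN : Continuous N := Continuous.quotient_lift (by fun_prop) _
  obtain ⟨r, hwr, hr⟩ := exists_between hw
  obtain ⟨U, hU, hUr⟩ := (S.isEmbedding_char i).isOpen_iff.1 (isOpen_Iio.preimage hN : IsOpen
    (N ⁻¹' Set.Iio r))
  have hmem {z : E (S.dim i)} (hz : ‖z‖ < 1) : S.charMap i z ∈ U ↔ ‖z‖ < r := by
    rw [S.charMap_eq_incl i hz, ← Set.mem_preimage, hUr]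
    rfl
  have hvU : S.charMap i v ∈ U := by rwa [← h, hmem hw]
  have hc : Filter.Tendsto (fun t : ℝ => S.charMap i (t • v)) (𝓝[<] 1) (𝓝 (S.charMap i v)) := by
    have : Continuous fun t : ℝ => S.charMap i (t • v) := by fun_prop
    simpa using (this.tendsto 1).mono_left nhdsWithin_le_nhds
  obtain ⟨t, ht, ht'⟩ := ((hc.eventually_mem (hU.mem_nhds hvU)).and
    (Ioo_mem_nhdsLT (max_lt one_pos hr))).exists
  have hnorm : ‖t • v‖ = t := by
    rw [norm_smul, hv, mul_one, Real.norm_of_nonneg ((le_max_left _ _).trans ht'.1.le)]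
  rw [hmem (by rw [hnorm]; exact ht'.2), hnorm] at ht
  exact ht.not_gt ((le_max_right _ _).trans_lt ht'.1)

lemma exists_dim_lt (i : S.Cell) {v : E (S.dim i)} (hv : ‖v‖ = 1) :
    ∃ j, S.dim j < S.dim i ∧ S.charMap i v ∈ S.cell j := by
  obtain ⟨j, hj⟩ := S.exists_mem_cell (S.charMap i v)
  refine ⟨j, S.dim_lt i j ?_ ⟨_, S.charMap_mem_range i v, hj⟩, hj⟩
  rintro rfl
  exact S.charMap_notMem_cell j hv hj

/-- In a union of cells, closedness can be tested on the closures of these cells: the closure of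
any cell meets only finitely many cells. -/
lemma isClosed_of_cells (J : Set S.Cell) {B : Set X} (hB : B ⊆ ⋃ j ∈ J, S.cell j)
    (h : ∀ j ∈ J, IsClosed (B ∩ closure (S.cell j))) : IsClosed B := by
  rw [S.isClosed_iff]
  intro i
  have : B ∩ closure (S.cell i) =
      (⋃ k ∈ J ∩ {j | (Set.range (S.char i) ∩ S.cell j).Nonempty}, B ∩ closure (S.cell k)) ∩
        closure (S.cell i) := by
    ext x
    simp only [Set.mem_inter_iff, Set.mem_iUnion, exists_prop, Set.mem_ofPred_eq]
    constructor
    · rintro ⟨hx, hx'⟩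
      obtain ⟨k, hk, hxk⟩ := Set.mem_iUnion₂.1 (hB hx)
      exact ⟨⟨k, ⟨hk, x, S.closure_cell_subset i hx', hxk⟩, hx, subset_closure hxk⟩, hx'⟩
    · rintro ⟨⟨k, -, hx, -⟩, hx'⟩
      exact ⟨hx, hx'⟩
  rw [this]
  exact (((S.finite_meets i).inter_of_right _).isClosed_biUnion fun k hk => h k hk.1).inter
    isClosed_closure

variable {Z : Set X} (hZ : S.IsSubcomplex Z)

include hZ in
lemma cell_subset_of_mem {i : S.Cell} {x : X} (hx : x ∈ S.cell i) (hxZ : x ∈ Z) :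
    S.cell i ⊆ Z := by
  obtain ⟨-, J, rfl⟩ := hZ
  obtain ⟨j, hj, hxj⟩ := Set.mem_iUnion₂.1 hxZ
  rw [S.eq_of_mem_cell hx hxj]
  exact Set.subset_biUnion_of_mem hj

include hZ in
/-- The sets `Z ∪ X⁽ᵖ⁾` are unions of cells. -/
lemma mem_relFiltration_iff {p : ℤ} (hp : 0 ≤ p) {i : S.Cell} {x : X} (hx : x ∈ S.cell i) :
    x ∈ S.relFiltration Z p ↔ S.cell i ⊆ Z ∨ (S.dim i : ℤ) ≤ p := by
  constructor
  · rintro ⟨-, h | h⟩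
    · exact .inl (S.cell_subset_of_mem hZ hx h)
    · obtain ⟨j, hj, hxj⟩ := Set.mem_iUnion₂.1 h
      rw [S.eq_of_mem_cell hx hxj]
      exact .inr hj
  · rintro (h | h)
    · exact ⟨hp, .inl (h hx)⟩
    · exact ⟨hp, .inr (Set.mem_iUnion₂.2 ⟨i, h, hx⟩)⟩

include hZ in
lemma range_char_subset_relFiltration {p : ℤ} {i : S.Cell} (hi : (S.dim i : ℤ) ≤ p) :
    Set.range (S.char i) ⊆ S.relFiltration Z p := by
  intro x hx
  obtain ⟨j, hj⟩ := S.exists_mem_cell x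
  rw [S.mem_relFiltration_iff hZ ((Int.natCast_nonneg _).trans hi) hj]
  right
  by_cases h : j = i
  · rwa [h]
  · have := S.dim_lt i j h ⟨x, hx, hj⟩
    lia

include hZ in
lemma closure_cell_subset_relFiltration {p : ℤ} (hp : 0 ≤ p) {i : S.Cell}
    (hi : S.cell i ⊆ Z ∨ (S.dim i : ℤ) ≤ p) : closure (S.cell i) ⊆ S.relFiltration Z p := by
  obtain hi | hi := hi
  · exact fun x hx => ⟨hp, .inl (closure_minimal hi hZ.1 hx)⟩
  · exact (S.closure_cell_subset i).trans (S.range_char_subset_relFiltration hZ hi)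

include hZ in
lemma isClosed_relFiltration {p : ℤ} (hp : 0 ≤ p) : IsClosed (S.relFiltration Z p) := by
  refine S.isClosed_of_cells {j | S.cell j ⊆ Z ∨ (S.dim j : ℤ) ≤ p} (fun x hx => ?_)
    fun j hj => ?_
  · obtain ⟨j, hj⟩ := S.exists_mem_cell x
    exact Set.mem_iUnion₂.2 ⟨j, (S.mem_relFiltration_iff hZ hp hj).1 hx, hj⟩
  · rw [Set.inter_eq_right.2 (S.closure_cell_subset_relFiltration hZ hp hj)]
    exact isClosed_closure

/-- The union of `Z` and the `p`-skeleton is obtained from the union of `Z` and the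
`(p - 1)`-skeleton by attaching the `p`-cells which are not in `Z`. -/
def relAttachment {p : ℕ} (hp : 1 ≤ p) : CellAttachment (S.relFiltration Z p) where
  W := Subtype.val ⁻¹' S.relFiltration Z (p - 1)
  isClosed_W := (S.isClosed_relFiltration hZ (by lia)).preimage continuous_subtype_val
  I := S.CellsNotIn Z p
  d i := S.dim i.1
  G i := S.G i.1
  χ i := ⟨fun v => ⟨S.charMap i.1 v, S.range_char_subset_relFiltration hZ (by rw [i.2.1])
    (S.charMap_mem_range i.1 v)⟩, by fun_prop⟩
  χ_mem i v hv := by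
    obtain ⟨j, hj, hv⟩ := S.exists_dim_lt i.1 hv
    have := i.2.1
    exact (S.mem_relFiltration_iff hZ (by lia) hv).2 (.inr (by lia))
  χ_notMem i v hv h := by
    have := (S.mem_relFiltration_iff hZ (by lia) (S.charMap_mem_cell i.1 hv)).1 h
    have h' := i.2.1
    exact this.elim i.2.2 fun h => by lia
  index_eq i j v w hv hw h := by
    have h' : S.charMap i.1 v = S.charMap j.1 w := congrArg Subtype.val h
    exact Subtype.ext (S.eq_of_mem_cell (S.charMap_mem_cell i.1 hv)
      (by rw [h']; exact S.charMap_mem_cell j.1 hw))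
  exists_eq i v w hv hw h := S.exists_eq_of_charMap_eq i.1 hv hw (congrArg Subtype.val h)
  χ_apply i g hg v := Subtype.ext (S.charMap_apply i.1 g hg v)
  cover y hy := by
    obtain ⟨j, hj⟩ := S.exists_mem_cell y
    have h₁ := (S.mem_relFiltration_iff hZ (by lia) hj).1 y.2
    have h₂ : ¬ _ := fun h => hy ((S.mem_relFiltration_iff hZ (by lia) hj).2 h)
    rw [not_or] at h₂
    have h₃ := h₁.resolve_left h₂.1
    rw [← S.image_ball j] at hj
    obtain ⟨v, hv, h⟩ := hj
    exact ⟨⟨j, by lia, h₂.1⟩, v, mem_ball_zero_iff.1 hv, Subtype.ext h⟩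
  isClosed_of B hB h := by
    have hcl (p : ℤ) (hp : 0 ≤ p) := S.isClosed_relFiltration hZ hp
    have key : IsClosed (Subtype.val '' B) := by
      refine S.isClosed_of_cells {j | S.cell j ⊆ Z ∨ (S.dim j : ℤ) ≤ p} ?_ fun j hj => ?_
      · rintro _ ⟨x, -, rfl⟩
        obtain ⟨j, hj⟩ := S.exists_mem_cell x
        exact Set.mem_iUnion₂.2 ⟨j, (S.mem_relFiltration_iff hZ (by lia) hj).1 x.2, hj⟩
      · -- the closure of a cell of `W` is contained in `W`; the closure of any other cell is
        -- contained in the image of the closed ball, which is compact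
        by_cases hj' : S.cell j ⊆ Z ∨ (S.dim j : ℤ) ≤ p - 1
        · have h₁ := S.closure_cell_subset_relFiltration hZ (by lia) hj'
          have h₂ : Subtype.val '' B ∩ closure (S.cell j) =
              Subtype.val '' (B ∩ Subtype.val ⁻¹' S.relFiltration Z (p - 1)) ∩
                closure (S.cell j) := by
            rw [Set.image_inter_preimage, Set.inter_assoc, Set.inter_eq_right.2 h₁]
          rw [h₂]
          exact ((hcl p (by lia)).isClosedEmbedding_subtypeVal.isClosedMap _ hB).inter
            isClosed_closure
        · rw [not_or] at hj'
          have hd : S.dim j = p := by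
            have := hj.resolve_left hj'.1
            lia
          have h₁ := ((isCompact_closedBall _ _).of_isClosed_subset (h ⟨j, hd, hj'.1⟩)
            Set.inter_subset_left).image (S.charMap j).continuous
          have h₂ : Subtype.val '' B ∩ closure (S.cell j) =
              S.charMap j '' (Metric.closedBall 0 1 ∩ {v | ∃ h, ⟨S.charMap j v, h⟩ ∈ B}) ∩
                closure (S.cell j) := by
            ext x
            refine and_congr_left fun hx => ⟨?_, ?_⟩
            · rintro ⟨y, hy, rfl⟩
              have := S.closure_cell_subset j hx
              rw [← S.image_closedBall] at this
              obtain ⟨v, hv, hvy⟩ := this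
              refine ⟨v, ⟨hv, hvy ▸ y.2, ?_⟩, hvy⟩
              rwa [show (⟨S.charMap j v, hvy ▸ y.2⟩ : S.relFiltration Z p) = y from
                Subtype.ext hvy]
            · rintro ⟨v, ⟨-, h, hv⟩, rfl⟩
              exact ⟨_, hv, rfl⟩
          rw [h₂]
          refine IsClosed.inter ?_ isClosed_closure
          convert h₁.isClosed using 3
          ext v
          exact ⟨fun ⟨_, h⟩ => h, fun h => ⟨_, h⟩⟩
    rw [← Set.preimage_image_eq B Subtype.val_injective]
    exact key.preimage continuous_subtype_val

end SymmetricCWComplex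

/-! ### The filtration by skeleta -/

namespace SymmetricCWComplex

variable {X : Type u} [TopologicalSpace X] [T2Space X] (S : SymmetricCWComplex X) {Z : Set X}

lemma relFiltration_of_neg {p : ℤ} (hp : p < 0) : S.relFiltration Z p = ∅ :=
  Set.eq_empty_of_forall_notMem fun _ hx => hp.not_ge hx.1

lemma relFiltration_of_nonneg {p : ℤ} (hp : 0 ≤ p) : S.relFiltration Z p = Z ∪ S.skeleton p :=
  Set.ext fun _ => and_iff_right hp

lemma relFiltration_eq_univ {N : ℕ} (hN : ∀ i, S.dim i ≤ N) {p : ℤ} (hp : N ≤ p) :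
    S.relFiltration Z p = Set.univ := by
  refine Set.eq_univ_of_forall fun x => ?_
  obtain ⟨i, hi⟩ := S.exists_mem_cell x
  have := hN i
  exact ⟨by lia, .inr (Set.mem_iUnion₂.2 ⟨i, by lia, hi⟩)⟩

/-- The relative chains of a subspace of `t` do not change when the subspace is regarded as a
subset of the space `t`. -/
def cokernelSubspaceIso (A : AddCommGrpCat.{u}) {s t : Set X} (h : s ⊆ t) :
    cokernel ((singularChains A).map (subspaceMap h)) ≅
      cokernel ((singularChains A).map (subspaceInc (Subtype.val ⁻¹' s : Set t))) :=
  cokernel.mapIso _ _ ((singularChains A).mapIso (TopCat.isoOfHomeo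
      { toFun := fun x => ⟨⟨x.1, h x.2⟩, x.2⟩
        invFun := fun x => ⟨x.1.1, x.2⟩
        left_inv := fun _ => rfl
        right_inv := fun _ => rfl
        continuous_toFun := by fun_prop
        continuous_invFun := by fun_prop }))
    (Iso.refl _) (by
      rw [Iso.refl_hom, Category.comp_id, Functor.mapIso_hom, ← Functor.map_comp]
      rfl)

end SymmetricCWComplex

end SymmCW

end

open SymmCW in
theorem theorem4p2 {X : Type u} [TopologicalSpace X] [T2Space X] (S : SymmetricCWComplex X)
    (hS : S.FiniteDimensional) (Z : Set X) (hZ : S.IsSubcomplex Z) (A : AddCommGrpCat.{u}) :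
    -- the first page
    (∀ q : ℤ, Nonempty
      (((S.relSpectralSequence Z A).page 1 le_rfl).X (0, q) ≅
        (homologyInt A q).obj (TopCat.of ↥(Z ∪ S.skeleton 0)))) ∧
    (∀ p : ℕ, 1 ≤ p → ∀ q : ℤ, Nonempty
      (((S.relSpectralSequence Z A).page 1 le_rfl).X ((p : ℤ), q) ≅
        ∐ fun i : S.CellsNotIn Z p => reducedHomology A (p + q - 1) (S.sphereQuotient i.1))) ∧
    (∀ p : ℤ, p < 0 → ∀ q : ℤ, IsZero (((S.relSpectralSequence Z A).page 1 le_rfl).X (p, q))) ∧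
    -- convergence: the differentials vanish from some page on, and the stable value is as stated
    (∃ (r₀ : ℤ) (hr₀ : 1 ≤ r₀), ∀ (r : ℤ) (hr : r₀ ≤ r),
      (∀ a b : ℤ × ℤ, ((S.relSpectralSequence Z A).page r (hr₀.trans hr)).d a b = 0) ∧
      ∀ p q : ℤ, Nonempty
        (((S.relSpectralSequence Z A).page r (hr₀.trans hr)).X (p, q) ≅
          gradedPiece A (p + q) (S.relFiltration Z p) (S.relFiltration Z (p - 1)))) := by
  have hY := S.monotone_relFiltration Z
  refine ⟨fun q => ?_, fun p hp q => ?_, fun p hp q => ?_, ?_⟩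
  · obtain ⟨e⟩ := nonempty_firstPageIso_of_isEmpty A _ hY 0 q (S.relFiltration_of_neg (by lia))
    rw [zero_add, S.relFiltration_of_nonneg le_rfl] at e
    exact ⟨e⟩
  · obtain ⟨e⟩ := (S.relAttachment hZ hp).nonempty_relativeIso A
      (fun i => hp.trans_eq i.2.1.symm) (p + q)
    exact ⟨firstPageIso A _ hY p q ≪≫
      (extHomology (p + q)).mapIso (SymmetricCWComplex.cokernelSubspaceIso A _) ≪≫ e⟩
  · exact isZero_page_of_eq A _ hY 1 le_rfl p q
      ((S.relFiltration_of_neg (by lia)).trans (S.relFiltration_of_neg hp).symm)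
  · obtain ⟨N, hN⟩ := hS
    exact exists_stable_page A _ hY N (Int.natCast_nonneg N) (fun p => S.relFiltration_of_neg)
      fun p => S.relFiltration_eq_univ hN
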